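/- Let $G=(V,E)$ be a finite simple graph and let $\chi:V\to\mathcal C\cup\{\bullet\}$ be a colouring of its vertices, where $\mathcal C$ is a finite set of colours and $\chi(v)=\bullet$ means that $v$ is uncoloured. For $X\subseteq V$ let $k(X)$ be the number of colours of $\mathcal C$ that occur in $X$, and assume that $k=k(V)\le 2$. Let $r:\mathcal C\to\mathbb R_{>0}$ and put $r(\bullet)=1$. A framework $(G,\chi,p)$ on $r\mathbb S^2$ is given by a map $p:V\to\mathbb R^3$ with $\|p(v)\|=r(\chi(v))$ for all $v\in V$. It is generic if every polynomial with rational coefficients, in variables for the coordinates of all $p(v)$ and for the radii $r(c)$, $c\in\mathcal C$, that vanishes at $(p,r)$ belongs to the ideal generated by the polynomials $\sum_{i=1}^{3}x_{v,i}^2-t_{\chi(v)}^2$ ($v\in V$), where $t_\bullet=1$. The rigidity matrix $R(G,\chi,p)$ has rows indexed by $E\sqcup V$ and columns indexed by the $3|V|$ coordinates of the vertices and by $\mathcal C$. The row of an edge $uw$ has $p(u)-p(w)$ in the columns of $u$, $p(w)-p(u)$ in the columns of $w$, and zeros elsewhere. The row of a vertex $v$ has $p(v)$ in the columns of $v$,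 a $1$ in the column $\chi(v)$ if $v$ is coloured, and zeros elsewhere. A cover of $G$ is a family $\mathcal X$ of subsets of $V$ with at least two elements each such that both ends of every edge of $G$ lie in a common member of $\mathcal X$. It is 1-thin if any two distinct members share at most one vertex, and, for $X\subseteq V$, it is $X$-restricted if every $X_i\in\mathcal X$ with $|X_i|\ge 3$ satisfies $X_i\subseteq X$. Theorem. If $(G,\chi,p)$ is a generic framework on $r\mathbb S^2$ with $k\le 2$, then $$\operatorname{rank} R(G,\chi,p)=|V|+\min\Big\{\sum_{X_i\in\mathcal X}(2|X_i|-3)+k(X)\Big\},$$ where the minimum is over all subsets $X\subseteq V$ and all $X$-restricted 1-thin covers $\mathcal X$ of $G$. -/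

import Mathlib

open MvPolynomial

noncomputable section

namespace ExpandingSpheres

variable {V C : Type*}

/-- The number `k(X)` of colours occurring in a set `X` of vertices, for a colouring
`χ : V → C ∪ {•}`; `none` is the sign `•`, i.e. `χ v = none` says that `v` is uncoloured. -/
def numColours [DecidableEq C] (χ : V → Option C) (X : Finset V) : ℕ :=
  (Finset.eraseNone (X.image χ)).card

/-- The radius of the sphere of a vertex: `r c` for colour `c`, and `1` for uncoloured vertices. -/
def radius (r : C → ℝ) : Option C → ℝ
  | none => 1
  | some c => r c

/-- A framework on the family `r𝕊^d` of concentric spheres in `ℝ^{d+1}`, for a vertex set `V` with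
colouring `χ`. -/
structure Framework (d : ℕ) (χ : V → Option C) where
  /-- the radii of the coloured spheres -/
  r : C → ℝ
  r_pos : ∀ c, 0 < r c
  /-- the positions of the joints -/
  p : V → EuclideanSpace ℝ (Fin (d + 1))
  mem_sphere : ∀ v, p v ∈ Metric.sphere (0 : EuclideanSpace ℝ (Fin (d + 1))) (radius r (χ v))

/-- The square of the radius as a polynomial: the square of the variable of colour `c`, or `1`. -/
def radiusSqPoly (V : Type*) {C : Type*} (d : ℕ) :
    Option C → MvPolynomial ((V × Fin (d + 1)) ⊕ C) ℚ
  | none => 1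
  | some c => X (Sum.inr c) ^ 2

/-- The defining polynomial of the sphere on which the vertex `v` lies. There is one variable for
each coordinate of each vertex and one variable for the radius of each colour. -/
def spherePoly {d : ℕ} (χ : V → Option C) (v : V) : MvPolynomial ((V × Fin (d + 1)) ⊕ C) ℚ :=
  (∑ i : Fin (d + 1), X (Sum.inl (v, i)) ^ 2) - radiusSqPoly V d (χ v)

/-- A framework on `r𝕊^d` is generic if every polynomial with rational coefficients that vanishes
at the coordinates of `p` and `r` is in the ideal generated by the defining polynomials of the
spheres. -/
def Framework.IsGeneric {d : ℕ} {χ : V → Option C} (P : Framework d χ) : Prop :=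
  ∀ f : MvPolynomial ((V × Fin (d + 1)) ⊕ C) ℚ,
    aeval (Sum.elim (fun x : V × Fin (d + 1) => P.p x.1 x.2) P.r) f = 0 →
      f ∈ Ideal.span (Set.range (spherePoly (d := d) χ))

/-- The rigidity matrix `R(G, χ, p)`. The rows are indexed by the edges and the vertices, the
columns by the `d + 1` coordinates of each vertex and by the colours. The row of an edge `uw` has
`p u - p w` in the columns of `u`, `p w - p u` in the columns of `w`, and zeros elsewhere. The row
of a vertex `v` has `p v` in the columns of `v`, a `1` in the column of the colour of `v` if `v` is
coloured, and zeros elsewhere. -/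
def rigidityMatrix [DecidableEq V] [DecidableEq C] {d : ℕ} (G : SimpleGraph V)
    (χ : V → Option C) (p : V → EuclideanSpace ℝ (Fin (d + 1))) :
    Matrix (G.edgeSet ⊕ V) ((V × Fin (d + 1)) ⊕ C) ℝ
  | Sum.inl e, Sum.inl (w, i) =>
      if h : w ∈ (e : Sym2 V) then p w i - p (Sym2.Mem.other h) i else 0
  | Sum.inl _, Sum.inr _ => 0
  | Sum.inr v, Sum.inl (w, i) => if w = v then p v i else 0
  | Sum.inr v, Sum.inr c => if χ v = some c then 1 else 0

/-- A cover of `G`: a family of vertex sets with at least two elements each, such that every edge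
of `G` is induced by a member of the family. -/
def IsCover (G : SimpleGraph V) (𝒳 : Finset (Finset V)) : Prop :=
  (∀ Y ∈ 𝒳, 2 ≤ Y.card) ∧ ∀ u v, G.Adj u v → ∃ Y ∈ 𝒳, u ∈ Y ∧ v ∈ Y

/-- A family of vertex sets is `1`-thin if any two of its members share at most one vertex. -/
def IsOneThin [DecidableEq V] (𝒳 : Finset (Finset V)) : Prop :=
  ∀ Y ∈ 𝒳, ∀ Z ∈ 𝒳, Y ≠ Z → (Y ∩ Z).card ≤ 1

/-- A family of vertex sets is `X`-restricted if its members with at least three elements are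
subsets of `X`. -/
def IsRestricted (X : Finset V) (𝒳 : Finset (Finset V)) : Prop :=
  ∀ Y ∈ 𝒳, 3 ≤ Y.card → Y ⊆ X

end ExpandingSpheres

end

/-! The kernel of the rigidity matrix is the space of infinitesimal motions: velocities of the
vertices together with speeds of the radii. Hence its rank is |V| + rk(E), where rk(F) counts the
conditions that F imposes on the motions with all radii free. More generally, let rk_D be the rank
when only the radii of colours in D vary; rk_∅ is rigidity on fixed spheres. Freeing a colour raises
the rank by at most one, and only if the colour occurs at an edge, so rk_D(T) ≤ g(T) := rk_∅(T) +
|colours of D at T|.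

The core is `rk_eq_card_of_forall_le`: for k ≤ 2, a set F is independent for D as soon as |T| ≤ g(T)
for all T ⊆ F. Since g is monotone and submodular, Edmonds' formula `exists_indep_card_ge` then
gives rk_D(E) = min |E \ T| + g(T). The term rk_∅(T) is the value of a 1-thin cover of T
(`exists_cover`, from Laman's theorem `rk_empty_of_isSparse`); edges outside T become two-element
members worth 1 each, and X is the set of ends of T. The upper bound `rk_le_of_cover` is
subadditivity, plus the three rotations of each member.

The core is proved by deleting a vertex v of degree at most 3, which exists because |F| ≤ 2|W| - 3 +
2. Degrees up to 2 are easy. For neighbours a, b, c, genericity allows v to be tested anywhere on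
its sphere; if some motion of F - v changes a radius at v, a, b, c or strains the triangle abc, some
position makes all three edges independent (`rk_insert_three`). Otherwise F - v has the same motions
as F - v + abc with those radii frozen. The rank formula for this smaller graph yields a set T
which, enlarged by the triangle and the edges at v, violates the count: on fixed spheres three edges
from v to a triangle add only 2 to the rank. -/

noncomputable section

namespace ExpandingSpheres

open Matrix Module

/-! ### Spaces of motions and the rank functions of sets of edges -/

section Motions

section LinearAlgebra

variable {K M : Type*} [Field K] [AddCommGroup M] [Module K M] [FiniteDimensional K M]

theorem finrank_le_finrank_inf_ker_add_one (S : Submodule K M) (f : M →ₗ[K] K) :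
    finrank K S ≤ finrank K ↥(S ⊓ LinearMap.ker f) + 1 := by
  have h1 := Submodule.finrank_sup_add_finrank_inf_eq S (LinearMap.ker f)
  have h2 := LinearMap.finrank_range_add_finrank_ker f
  have h3 : finrank K (LinearMap.range f) ≤ 1 :=
    (Submodule.finrank_le _).trans (finrank_self K).le
  have h4 := Submodule.finrank_le (S ⊔ LinearMap.ker f)
  omega

theorem finrank_inf_ker_add_one {S : Submodule K M} {f : M →ₗ[K] K} {m : M} (hm : m ∈ S)
    (hf : f m ≠ 0) : finrank K ↥(S ⊓ LinearMap.ker f) + 1 = finrank K S := by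
  refine le_antisymm ?_ (finrank_le_finrank_inf_ker_add_one S f)
  refine Submodule.finrank_lt_finrank_of_lt (lt_of_le_of_ne inf_le_left fun h => hf ?_)
  exact (h.ge hm).2

end LinearAlgebra

variable {V C : Type*}

/-- The speed at which (half the square of) the radius of a sphere shrinks. -/
def speed (σ : C → ℝ) : Option C → ℝ
  | none => 0
  | some c => σ c

@[simp] theorem speed_none (σ : C → ℝ) : speed σ none = 0 := rfl

@[simp] theorem speed_some (σ : C → ℝ) (c : C) : speed σ (some c) = σ c := rfl

@[simp] theorem speed_zero (o : Option C) : speed (0 : C → ℝ) o = 0 := by cases o <;> rfl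

theorem speed_add (σ τ : C → ℝ) (o : Option C) : speed (σ + τ) o = speed σ o + speed τ o := by
  cases o <;> simp

theorem speed_smul (a : ℝ) (σ : C → ℝ) (o : Option C) : speed (a • σ) o = a * speed σ o := by
  cases o <;> simp

/-- Velocities of the vertices and speeds of the radii. -/
abbrev Velocity (V C : Type*) := (V → Fin 3 → ℝ) × (C → ℝ)

/-- The rate of change of (half the square of) the distance of two vertices. -/
def strain (C : Type*) (p : V → Fin 3 → ℝ) (u w : V) : Velocity V C →ₗ[ℝ] ℝ where
  toFun m := (p u - p w) ⬝ᵥ (m.1 u - m.1 w)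
  map_add' m n := by
    rw [← dotProduct_add]; congr 1; simp only [Prod.fst_add, Pi.add_apply]; abel
  map_smul' a m := by
    rw [RingHom.id_apply, smul_eq_mul, ← smul_eq_mul, ← dotProduct_smul]; congr 1
    simp [smul_sub]

theorem strain_apply (p : V → Fin 3 → ℝ) (u w : V) (m : Velocity V C) :
    strain C p u w m = (p u - p w) ⬝ᵥ (m.1 u - m.1 w) := rfl

theorem strain_comm (p : V → Fin 3 → ℝ) (u w : V) : strain C p u w = strain C p w u := by
  ext1 <;> ext m <;> simp only [LinearMap.comp_apply, strain_apply] <;>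
    rw [← neg_sub, neg_dotProduct, ← dotProduct_neg, neg_sub]

/-- The infinitesimal motions of the edges in `F` in which only radii of colours in `D` vary. -/
def motions (χ : V → Option C) (p : V → Fin 3 → ℝ) (D : Finset C) (F : Finset (Sym2 V)) :
    Submodule ℝ (Velocity V C) where
  carrier := {m | (∀ u w, s(u, w) ∈ F → strain C p u w m = 0) ∧
    (∀ v, p v ⬝ᵥ m.1 v + speed m.2 (χ v) = 0) ∧ ∀ c, c ∉ D → m.2 c = 0}
  add_mem' {m n} hm hn := by
    refine ⟨fun u w h => by rw [map_add, hm.1 u w h, hn.1 u w h, add_zero], fun v => ?_,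
      fun c hc => by simp [hm.2.2 c hc, hn.2.2 c hc]⟩
    have h1 := hm.2.1 v
    have h2 := hn.2.1 v
    simp only [Prod.fst_add, Prod.snd_add, Pi.add_apply, dotProduct_add, speed_add]
    linarith
  zero_mem' := by simp
  smul_mem' a m hm := by
    refine ⟨fun u w h => by rw [map_smul, hm.1 u w h, smul_zero], fun v => ?_,
      fun c hc => by simp [hm.2.2 c hc]⟩
    have h1 := hm.2.1 v
    simp only [Prod.smul_fst, Prod.smul_snd, Pi.smul_apply, dotProduct_smul, speed_smul,
      smul_eq_mul]
    rw [← mul_add, h1, mul_zero]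

variable {χ : V → Option C} {p : V → Fin 3 → ℝ} {D D' : Finset C} {F F' : Finset (Sym2 V)}
  {m : Velocity V C}

theorem mem_motions : m ∈ motions χ p D F ↔ (∀ u w, s(u, w) ∈ F → strain C p u w m = 0) ∧
    (∀ v, p v ⬝ᵥ m.1 v + speed m.2 (χ v) = 0) ∧ ∀ c, c ∉ D → m.2 c = 0 := Iff.rfl

theorem motions_anti (h : F ⊆ F') : motions χ p D F' ≤ motions χ p D F := fun _ hm =>
  ⟨fun u w hu => hm.1 u w (h hu), hm.2⟩

theorem motions_mono (h : D ⊆ D') : motions χ p D F ≤ motions χ p D' F := fun _ hm =>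
  ⟨hm.1, hm.2.1, fun c hc => hm.2.2 c fun hc' => hc (h hc')⟩

theorem motions_union [DecidableEq V] :
    motions χ p D (F ∪ F') = motions χ p D F ⊓ motions χ p D F' := by
  ext m
  simp only [Submodule.mem_inf, mem_motions, Finset.mem_union]
  constructor
  · rintro ⟨h1, h2⟩
    exact ⟨⟨fun u w h => h1 u w (.inl h), h2⟩, ⟨fun u w h => h1 u w (.inr h), h2⟩⟩
  · rintro ⟨⟨h1, h2⟩, ⟨h3, -⟩⟩
    exact ⟨fun u w h => h.elim (h1 u w) (h3 u w), h2⟩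

theorem motions_insert [DecidableEq V] (u w : V) :
    motions χ p D (insert s(u, w) F) = motions χ p D F ⊓ LinearMap.ker (strain C p u w) := by
  ext m
  simp only [Submodule.mem_inf, mem_motions, Finset.mem_insert, LinearMap.mem_ker]
  constructor
  · rintro ⟨h1, h2⟩
    exact ⟨⟨fun a b h => h1 a b (.inr h), h2⟩, h1 u w (.inl rfl)⟩
  · rintro ⟨⟨h1, h2⟩, h3⟩
    refine ⟨fun a b h => h.elim (fun h => ?_) (h1 a b), h2⟩
    rcases Sym2.eq_iff.1 h with ⟨rfl, rfl⟩ | ⟨rfl, rfl⟩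
    · exact h3
    · rwa [strain_comm]

theorem motions_insert_eq_self [DecidableEq V] {u w : V}
    (h : ∀ m ∈ motions χ p D F, strain C p u w m = 0) :
    motions χ p D (insert s(u, w) F) = motions χ p D F := by
  rw [motions_insert]
  exact inf_eq_left.2 fun m hm => LinearMap.mem_ker.2 (h m hm)

theorem motions_erase [DecidableEq C] (c : C) : motions χ p (D.erase c) F =
    motions χ p D F ⊓ LinearMap.ker ((LinearMap.proj c).comp (LinearMap.snd ℝ _ (C → ℝ))) := by
  ext m
  simp only [Submodule.mem_inf, mem_motions, Finset.mem_erase, LinearMap.mem_ker,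
    LinearMap.comp_apply, LinearMap.snd_apply, LinearMap.proj_apply, not_and]
  constructor
  · rintro ⟨h1, h2, h3⟩
    exact ⟨⟨h1, h2, fun d hd => h3 d fun _ => hd⟩, h3 c fun h => (h rfl).elim⟩
  · rintro ⟨⟨h1, h2, h3⟩, h4⟩
    refine ⟨h1, h2, fun d hd => ?_⟩
    by_cases hdc : d = c
    · rw [hdc, h4]
    · exact h3 d (hd hdc)

open Classical in
/-- The colours in `D` that occur at an edge of `F`. -/
def coloursAt (χ : V → Option C) (D : Finset C) (F : Finset (Sym2 V)) : Finset C :=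
  D.filter fun c => ∃ e ∈ F, ∃ v ∈ e, χ v = some c

theorem mem_coloursAt {c : C} :
    c ∈ coloursAt χ D F ↔ c ∈ D ∧ ∃ e ∈ F, ∃ v ∈ e, χ v = some c := by
  simp [coloursAt]

variable [Fintype V]

/-- The dimension of the kernel of a nonzero functional on `ℝ³`. -/
theorem finrank_ker_dotProduct {x : Fin 3 → ℝ} (hx : x ≠ 0) :
    finrank ℝ (LinearMap.ker (dotProductBilin ℝ ℝ x : (Fin 3 → ℝ) →ₗ[ℝ] ℝ)) = 2 := by
  have h : (dotProductBilin ℝ ℝ x : (Fin 3 → ℝ) →ₗ[ℝ] ℝ) ≠ 0 := fun h => by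
    have := LinearMap.congr_fun h x
    simp only [dotProductBilin_apply_apply, LinearMap.zero_apply, dotProduct_self_eq_zero] at this
    exact hx this
  have := Module.Dual.finrank_ker_add_one_of_ne_zero h
  simpa using this

theorem finrank_motions_empty_empty (hp : ∀ v, p v ≠ 0) :
    finrank ℝ (motions χ p ∅ ∅) = 2 * Fintype.card V := by
  let e : motions χ p ∅ ∅ ≃ₗ[ℝ]
      ((v : V) → LinearMap.ker (dotProductBilin ℝ ℝ (p v) : (Fin 3 → ℝ) →ₗ[ℝ] ℝ)) :=
    { toFun := fun m v => ⟨m.1.1 v, by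
        have h := m.2.2.1 v
        have h0 : m.1.2 = 0 := funext fun c => m.2.2.2 c (Finset.notMem_empty c)
        rw [h0, speed_zero, add_zero] at h
        simpa using h⟩
      map_add' := fun _ _ => rfl
      map_smul' := fun _ _ => rfl
      invFun := fun q => ⟨(fun v => q v, 0), by
        refine ⟨by simp, fun v => ?_, by simp⟩
        have := LinearMap.mem_ker.1 (q v).2
        rw [dotProductBilin_apply_apply] at this
        simpa only [speed_zero, add_zero] using this⟩
      left_inv := fun m => by
        have h0 : m.1.2 = 0 := funext fun c => m.2.2.2 c (Finset.notMem_empty c)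
        ext <;> simp [h0]
      right_inv := fun q => rfl }
  rw [e.finrank_eq, finrank_pi_fintype]
  simp [finrank_ker_dotProduct (hp _), mul_comm]

variable [Fintype C]

theorem finrank_motions_erase [DecidableEq C] {c : C} (hm : m ∈ motions χ p D F)
    (hc : m.2 c ≠ 0) :
    finrank ℝ (motions χ p (D.erase c) F) + 1 = finrank ℝ (motions χ p D F) := by
  rw [motions_erase]
  exact finrank_inf_ker_add_one hm hc

/-- The velocities that expand the spheres of one colour radially. -/
def expansion [DecidableEq C] (χ : V → Option C) (p : V → Fin 3 → ℝ) (c : C) : Velocity V C :=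
  -- The factor makes the product of `p v` with its velocity equal to -1, which cancels the speed 1.
  (fun v => if χ v = some c then -(p v ⬝ᵥ p v)⁻¹ • p v else 0, Pi.single c 1)

omit [Fintype V] [Fintype C] in
theorem expansion_mem_motions [DecidableEq C] (hp : ∀ v, p v ≠ 0) {c : C} (hc : c ∈ D)
    (hF : ∀ e ∈ F, ∀ v ∈ e, χ v ≠ some c) : expansion χ p c ∈ motions χ p D F := by
  refine ⟨fun u w h => ?_, fun v => ?_, fun d hd => ?_⟩
  · have hu := hF _ h u (Sym2.mem_mk_left u w)
    have hw := hF _ h w (Sym2.mem_mk_right u w)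
    simp [strain_apply, expansion, hu, hw]
  · have h0 : p v ⬝ᵥ p v ≠ 0 := fun h => hp v (dotProduct_self_eq_zero.1 h)
    by_cases h : χ v = some c
    · simp [expansion, h, h0]
    · rcases hv : χ v with _ | d
      · simp [expansion, hv]
      · have : d ≠ c := fun hd => h (by rw [hv, hd])
        simp [expansion, hv, this]
  · have : d ≠ c := fun h => hd (h ▸ hc)
    simp [expansion, this]

/-- A colour that meets no edge is worth exactly one dimension, given by the radial expansion of its
spheres. -/
theorem finrank_motions_erase_of_forall_ne [DecidableEq C] (hp : ∀ v, p v ≠ 0) {c : C}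
    (hc : c ∈ D) (hF : ∀ e ∈ F, ∀ v ∈ e, χ v ≠ some c) :
    finrank ℝ (motions χ p (D.erase c) F) + 1 = finrank ℝ (motions χ p D F) :=
  finrank_motions_erase (expansion_mem_motions hp hc hF) (by simp [expansion])

theorem finrank_motions_empty (hp : ∀ v, p v ≠ 0) (D : Finset C) :
    finrank ℝ (motions χ p D ∅) = 2 * Fintype.card V + D.card := by
  classical
  induction D using Finset.induction_on with
  | empty => simpa using finrank_motions_empty_empty hp
  | insert c D hc ih =>
    rw [← finrank_motions_erase_of_forall_ne hp (Finset.mem_insert_self c D) (by simp),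
      Finset.erase_insert hc, ih, Finset.card_insert_of_notMem hc, add_assoc]

/-- The rank of a set of edges when the radii of the colours in `D` may vary. -/
def rk (χ : V → Option C) (p : V → Fin 3 → ℝ) (D : Finset C) (F : Finset (Sym2 V)) : ℕ :=
  -- The truncated subtraction is exact, since edges only shrink the space of motions.
  finrank ℝ (motions χ p D ∅) - finrank ℝ (motions χ p D F)

theorem rk_add_finrank : rk χ p D F + finrank ℝ (motions χ p D F) =
    finrank ℝ (motions χ p D ∅) :=
  Nat.sub_add_cancel (Submodule.finrank_mono (motions_anti (Finset.empty_subset F)))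

omit [Fintype V] [Fintype C] in
theorem rk_empty : rk χ p D ∅ = 0 := Nat.sub_self _

theorem rk_mono (h : F ⊆ F') : rk χ p D F ≤ rk χ p D F' :=
  Nat.sub_le_sub_left (Submodule.finrank_mono (motions_anti h)) _

/-- The motions of F ∪ F' are the intersection of the two spaces, and their sum lies in the motions
of F ∩ F'; the dimension formula gives submodularity. -/
theorem rk_union_add_rk_inter [DecidableEq V] (F F' : Finset (Sym2 V)) :
    rk χ p D (F ∪ F') + rk χ p D (F ∩ F') ≤ rk χ p D F + rk χ p D F' := by
  have h1 := Submodule.finrank_sup_add_finrank_inf_eq (motions χ p D F) (motions χ p D F')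
  rw [← motions_union] at h1
  have h2 : finrank ℝ ↥(motions χ p D F ⊔ motions χ p D F') ≤
      finrank ℝ (motions χ p D (F ∩ F')) := Submodule.finrank_mono
    (sup_le (motions_anti Finset.inter_subset_left) (motions_anti Finset.inter_subset_right))
  have h3 := rk_add_finrank (χ := χ) (p := p) (D := D) (F := F ∪ F')
  have h4 := rk_add_finrank (χ := χ) (p := p) (D := D) (F := F ∩ F')
  have h5 := rk_add_finrank (χ := χ) (p := p) (D := D) (F := F)
  have h6 := rk_add_finrank (χ := χ) (p := p) (D := D) (F := F')
  omega

theorem rk_insert_le [DecidableEq V] (e : Sym2 V) :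
    rk χ p D (insert e F) ≤ rk χ p D F + 1 := by
  induction e with | _ u w => ?_
  have h1 := finrank_le_finrank_inf_ker_add_one (motions χ p D F) (strain C p u w)
  rw [← motions_insert] at h1
  have h2 := rk_add_finrank (χ := χ) (p := p) (D := D) (F := F)
  have h3 := rk_add_finrank (χ := χ) (p := p) (D := D) (F := insert s(u, w) F)
  omega

theorem rk_insert [DecidableEq V] {u w : V} (hm : m ∈ motions χ p D F)
    (hs : strain C p u w m ≠ 0) : rk χ p D (insert s(u, w) F) = rk χ p D F + 1 := by
  have h1 := finrank_inf_ker_add_one hm hs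
  rw [← motions_insert] at h1
  have h2 := rk_add_finrank (χ := χ) (p := p) (D := D) (F := F)
  have h3 := rk_add_finrank (χ := χ) (p := p) (D := D) (F := insert s(u, w) F)
  omega

theorem rk_union_le_add_card [DecidableEq V] (F F' : Finset (Sym2 V)) :
    rk χ p D (F ∪ F') ≤ rk χ p D F + F'.card := by
  induction F' using Finset.induction_on with
  | empty => simp
  | insert e F' he ih =>
    rw [Finset.union_insert, Finset.card_insert_of_notMem he]
    have := rk_insert_le (χ := χ) (p := p) (D := D) (F := F ∪ F') e
    omega

theorem rk_le_card : rk χ p D F ≤ F.card := by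
  classical
  simpa [rk_empty] using rk_union_le_add_card (χ := χ) (p := p) (D := D) ∅ F

/-- Freeing a colour adds one degree of freedom in all; if the colour misses F, the motions of F
gain it too and the rank is unchanged. -/
theorem rk_le_rk_empty_add (hp : ∀ v, p v ≠ 0) (D : Finset C) :
    rk χ p D F ≤ rk χ p ∅ F + (coloursAt χ D F).card := by
  classical
  induction D using Finset.induction_on with
  | empty => simp
  | insert c D hc ih =>
    have h1 := rk_add_finrank (χ := χ) (p := p) (D := D) (F := F)
    have h2 := rk_add_finrank (χ := χ) (p := p) (D := insert c D) (F := F)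
    rw [finrank_motions_empty hp] at h1 h2
    rw [Finset.card_insert_of_notMem hc] at h2
    by_cases h : ∃ e ∈ F, ∃ v ∈ e, χ v = some c
    · have h0 : coloursAt χ (insert c D) F = insert c (coloursAt χ D F) := by
        ext d
        simp only [mem_coloursAt, Finset.mem_insert]
        constructor
        · rintro ⟨rfl | h1, h2⟩
          exacts [.inl rfl, .inr ⟨h1, h2⟩]
        · rintro (rfl | ⟨h1, h2⟩)
          exacts [⟨.inl rfl, h⟩, ⟨.inr h1, h2⟩]
      rw [h0, Finset.card_insert_of_notMem (by simp [mem_coloursAt, hc])]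
      have h3 : finrank ℝ (motions χ p D F) ≤ finrank ℝ (motions χ p (insert c D) F) :=
        Submodule.finrank_mono (motions_mono (Finset.subset_insert c D))
      omega
    · have h0 : coloursAt χ D F ⊆ coloursAt χ (insert c D) F := fun d hd => by
        rw [mem_coloursAt] at hd ⊢
        exact ⟨Finset.mem_insert_of_mem hd.1, hd.2⟩
      push Not at h
      have h3 := finrank_motions_erase_of_forall_ne (F := F) hp (Finset.mem_insert_self c D) h
      rw [Finset.erase_insert hc] at h3
      have := Finset.card_le_card h0
      omega

end Motions

/-! ### Rotations, vertices of degree at most two, and the obstruction at degree three -/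

section GeneralPosition

variable {V C : Type*} {χ : V → Option C} {p : V → Fin 3 → ℝ} {D : Finset C}
  {F : Finset (Sym2 V)} {m : Velocity V C}

/-- A rotation that fixes two non-parallel vectors is trivial; hence rotations contribute three full
dimensions. -/
theorem eq_zero_of_cross_eq_zero {x a b : Fin 3 → ℝ} (h : a ⨯₃ b ≠ 0) (ha : x ⨯₃ a = 0)
    (hb : x ⨯₃ b = 0) : x = 0 := by
  have h1 : (x ⬝ᵥ x) • (a ⨯₃ b) = 0 := by
    have a0 := congrFun ha 0
    have a1 := congrFun ha 1
    have a2 := congrFun ha 2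
    have b0 := congrFun hb 0
    have b1 := congrFun hb 1
    have b2 := congrFun hb 2
    simp only [cross_apply, cons_val, Pi.zero_apply] at a0 a1 a2 b0 b1 b2
    ext i
    simp only [Pi.smul_apply, cross_apply, vec3_dotProduct, smul_eq_mul, Pi.zero_apply]
    fin_cases i <;> simp only [cons_val, Fin.zero_eta, Fin.mk_one, Fin.reduceFinMk] <;> grind
  rcases smul_eq_zero.1 h1 with h1 | h1
  · exact dotProduct_self_eq_zero.1 h1
  · exact (h h1).elim

/-- Vertices outside `W` move freely on their spheres, and `W` is rotated. -/
theorem rk_empty_add_three_le [Fintype V] [Fintype C] [DecidableEq V] (hp : ∀ v, p v ≠ 0)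
    {W : Finset V} {a b : V} (ha : a ∈ W) (hb : b ∈ W) (hab : p a ⨯₃ p b ≠ 0)
    (hF : ∀ e ∈ F, ∀ v ∈ e, v ∈ W) : rk χ p ∅ F + 3 ≤ 2 * W.card := by
  let K := fun v : V => LinearMap.ker (dotProductBilin ℝ ℝ (p v) : (Fin 3 → ℝ) →ₗ[ℝ] ℝ)
  have hK : ∀ v (q : K v), p v ⬝ᵥ (q : Fin 3 → ℝ) = 0 := fun v q => by
    have := LinearMap.mem_ker.1 q.2
    rwa [dotProductBilin_apply_apply] at this
  let g : (((v : ↥(Wᶜ)) → K v) × (Fin 3 → ℝ)) →ₗ[ℝ] motions χ p ∅ F :=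
    { toFun := fun t => ⟨(fun v => t.2 ⨯₃ p v +
          if h : v ∈ Wᶜ then (t.1 ⟨v, h⟩ : Fin 3 → ℝ) else 0, 0), by
        refine ⟨fun u w h => ?_, fun v => ?_, by simp⟩
        · have hu := hF _ h u (Sym2.mem_mk_left u w)
          have hw := hF _ h w (Sym2.mem_mk_right u w)
          simp only [strain_apply, Finset.mem_compl, hu, hw, not_true_eq_false, dite_false,
            add_zero]
          rw [← map_sub, dot_cross_self]
        · simp only [dotProduct_add, speed_zero, add_zero, dot_cross_self, zero_add]
          split_ifs with h
          · exact hK _ _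
          · simp⟩
      map_add' := fun s t => by
        ext v i
        · simp only [Submodule.coe_add, Prod.fst_add, Pi.add_apply, Prod.snd_add, map_add,
            LinearMap.add_apply]
          split_ifs
          · simp only [Pi.add_apply]; ring
          · simp only [Pi.zero_apply, add_zero]
        · simp
      map_smul' := fun r t => by
        ext v i
        · simp only [Submodule.coe_smul, Prod.smul_fst, Pi.smul_apply, Prod.smul_snd, map_smul,
            LinearMap.smul_apply, RingHom.id_apply]
          split_ifs <;> simp [mul_add]
        · simp }
  have hg : Function.Injective g := by
    rw [← LinearMap.ker_eq_bot, LinearMap.ker_eq_bot']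
    intro t ht
    have h0 : ∀ v, t.2 ⨯₃ p v + (if h : v ∈ Wᶜ then (t.1 ⟨v, h⟩ : Fin 3 → ℝ) else 0) = 0 :=
      fun v => congrFun (congrArg (fun m : motions χ p ∅ F => m.1.1) ht) v
    have h1 : t.2 = 0 := by
      refine eq_zero_of_cross_eq_zero hab ?_ ?_
      · simpa [ha] using h0 a
      · simpa [hb] using h0 b
    refine Prod.ext (funext fun v => Subtype.ext ?_) h1
    have := h0 v
    rw [dif_pos v.2, h1] at this
    simpa using this
  have h1 := LinearMap.finrank_le_finrank_of_injective hg
  rw [finrank_prod, finrank_pi_fintype] at h1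
  simp only [K, finrank_ker_dotProduct (hp _)] at h1
  simp only [Finset.sum_const, Finset.card_univ, Fintype.card_coe, Finset.card_compl,
    finrank_fin_fun, smul_eq_mul] at h1
  have h2 := rk_add_finrank (χ := χ) (p := p) (D := ∅) (F := F)
  rw [finrank_motions_empty hp] at h2
  have h3 := Finset.card_le_univ W
  simp only [Finset.card_empty] at h2
  omega

/-- The velocities of a single vertex. -/
def single [DecidableEq V] (C : Type*) (v : V) (x : Fin 3 → ℝ) : Velocity V C :=
  (Pi.single v x, 0)

theorem single_mem_motions [DecidableEq V] {v : V} {x : Fin 3 → ℝ} (hx : p v ⬝ᵥ x = 0)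
    (hF : ∀ e ∈ F, v ∉ e) : single C v x ∈ motions χ p D F := by
  refine ⟨fun u w h => ?_, fun u => ?_, by simp [single]⟩
  · have hu : u ≠ v := fun hu => hF _ h (hu ▸ Sym2.mem_mk_left u w)
    have hw : w ≠ v := fun hu => hF _ h (hu ▸ Sym2.mem_mk_right u w)
    simp [strain_apply, single, hu, hw]
  · rcases eq_or_ne u v with rfl | h
    · simp [single, hx]
    · simp [single, h]

theorem strain_single [DecidableEq V] {v a : V} (h : a ≠ v) {x : Fin 3 → ℝ}
    (hx : p v ⬝ᵥ x = 0) : strain C p v a (single C v x) = -(p a ⬝ᵥ x) := by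
  simp [strain_apply, single, h, sub_dotProduct, hx]

theorem rk_insert_of_notMem [Fintype V] [Fintype C] [DecidableEq V] {v a : V} (h : a ≠ v)
    (hpa : p v ⨯₃ p a ≠ 0) (hF : ∀ e ∈ F, v ∉ e) :
    rk χ p D (insert s(v, a) F) = rk χ p D F + 1 := by
  -- This velocity is tangent to the sphere at v and strains va by minus the squared norm of `p v ⨯₃
  -- p a`.
  have hx : p v ⬝ᵥ ((p v ⨯₃ p a) ⨯₃ p v) = 0 := dot_cross_self _ _
  refine rk_insert (single_mem_motions hx hF) ?_
  rw [strain_single h hx, neg_ne_zero, triple_product_permutation]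
  exact fun h => hpa (dotProduct_self_eq_zero.1 h)

theorem rk_insert_insert_of_notMem [Fintype V] [Fintype C] [DecidableEq V] {v a b : V}
    (ha : a ≠ v) (hb : b ≠ v) (hpa : p v ⬝ᵥ p a ⨯₃ p b ≠ 0) (hF : ∀ e ∈ F, v ∉ e) :
    rk χ p D (insert s(v, b) (insert s(v, a) F)) = rk χ p D F + 2 := by
  have hpa' : p v ⨯₃ p a ≠ 0 := fun h => hpa (by
    rw [← triple_product_permutation, h, dotProduct_zero])
  rw [show rk χ p D F + 2 = rk χ p D F + 1 + 1 from rfl, ← rk_insert_of_notMem ha hpa' hF]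
  -- The velocity `p v ⨯₃ p a` is tangent at v and keeps va, but strains vb by a triple product.
  have hx : p v ⬝ᵥ (p v ⨯₃ p a) = 0 := dot_self_cross _ _
  refine rk_insert (m := single C v (p v ⨯₃ p a)) ?_ ?_
  · rw [motions_insert]
    refine ⟨single_mem_motions hx hF, LinearMap.mem_ker.2 ?_⟩
    rw [strain_single ha hx, dot_cross_self, neg_zero]
  · rw [strain_single hb hx, neg_ne_zero, triple_product_permutation]
    exact hpa

/-- The obstruction to extending velocities of three linearly independent points `a`, `b`, `c`
to the point `v = x a + y b + z c`. -/
theorem extension_obstruction {v a b c v' a' b' c' : Fin 3 → ℝ} {x y z sv sa sb sc : ℝ}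
    (hv : v = x • a + y • b + z • c) (hv' : v ⬝ᵥ v' + sv = 0) (ha' : a ⬝ᵥ a' + sa = 0)
    (hb' : b ⬝ᵥ b' + sb = 0) (hc' : c ⬝ᵥ c' + sc = 0) (ha : (v - a) ⬝ᵥ (v' - a') = 0)
    (hb : (v - b) ⬝ᵥ (v' - b') = 0) (hc : (v - c) ⬝ᵥ (v' - c') = 0) :
    (1 - (x + y + z)) * (x * sa + y * sb + z * sc - sv) - (x * y * ((a - b) ⬝ᵥ (a' - b')) +
      y * z * ((b - c) ⬝ᵥ (b' - c')) + x * z * ((a - c) ⬝ᵥ (a' - c'))) = 0 := by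
  have h0 : x * ((v - a) ⬝ᵥ (v' - a')) + y * ((v - b) ⬝ᵥ (v' - b')) +
      z * ((v - c) ⬝ᵥ (v' - c')) = 0 := by rw [ha, hb, hc]; ring
  have h1 : x * (a ⬝ᵥ v') + y * (b ⬝ᵥ v') + z * (c ⬝ᵥ v') = -sv := by
    rw [hv] at hv'
    simp only [add_dotProduct, smul_dotProduct, smul_eq_mul] at hv'
    linarith
  have h2 : ∀ w, v ⬝ᵥ w = x * (a ⬝ᵥ w) + y * (b ⬝ᵥ w) + z * (c ⬝ᵥ w) := fun w => by
    rw [hv]; simp only [add_dotProduct, smul_dotProduct, smul_eq_mul]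
  simp only [sub_dotProduct, dotProduct_sub] at h0 ⊢
  rw [h2 a', h2 b', h2 c'] at h0
  grind

/-- A point on a sphere at which the extension obstruction does not vanish. -/
theorem exists_extension_obstruction_ne_zero {a b c : Fin 3 → ℝ} (hindep : a ⬝ᵥ b ⨯₃ c ≠ 0)
    {r sv sa sb sc ηab ηbc ηac : ℝ} (hr : 0 < r)
    (hc : c ⬝ᵥ c = r → sc = sv)
    (hne : ¬ (sv = 0 ∧ sa = 0 ∧ sb = 0 ∧ sc = 0 ∧ ηab = 0 ∧ ηbc = 0 ∧ ηac = 0)) :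
    ∃ x y z : ℝ, (x • a + y • b + z • c) ⬝ᵥ (x • a + y • b + z • c) = r ∧ z ≠ 0 ∧
      (1 - (x + y + z)) * (x * sa + y * sb + z * sc - sv) -
        (x * y * ηab + y * z * ηbc + x * z * ηac) ≠ 0 := by
  by_contra! hcon
  apply hne
  have hQ : ∀ x y z : ℝ, z ≠ 0 → 0 < (x • a + y • b + z • c) ⬝ᵥ (x • a + y • b + z • c) := by
    intro x y z hz
    refine lt_of_le_of_ne (Finset.sum_nonneg fun i _ => mul_self_nonneg _) fun h => ?_
    have h0 := dotProduct_self_eq_zero.1 h.symm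
    have : z * (a ⬝ᵥ b ⨯₃ c) = (x • a + y • b + z • c) ⬝ᵥ (a ⨯₃ b) := by
      simp only [add_dotProduct, smul_dotProduct, dot_self_cross, dot_cross_self, smul_eq_mul]
      rw [triple_product_permutation, triple_product_permutation]
      ring
    rw [h0, zero_dotProduct] at this
    exact (mul_ne_zero hz hindep) this
  -- An obstruction vanishing on the sphere vanishes at antipodal points, so its odd and even parts
  -- vanish separately. Rescaling any (x, y, z) to the sphere turns them into homogeneous
  -- identities.
  have key : ∀ x y z : ℝ, z ≠ 0 →
      x * sa + y * sb + z * sc + (x + y + z) * sv = 0 ∧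
      r * (-(x + y + z) * (x * sa + y * sb + z * sc) - (x * y * ηab + y * z * ηbc + x * z * ηac))
        = sv * ((x • a + y • b + z • c) ⬝ᵥ (x • a + y • b + z • c)) := by
    intro x y z hz
    set q := (x • a + y • b + z • c) ⬝ᵥ (x • a + y • b + z • c) with hq
    have hq0 : 0 < q := hQ x y z hz
    set t := √(r / q) with ht
    have ht2 : t * t = r / q := Real.mul_self_sqrt (div_pos hr hq0).le
    have ht0 : 0 < t := Real.sqrt_pos.2 (div_pos hr hq0)
    have hsc : ∀ u : ℝ, ((u * x) • a + (u * y) • b + (u * z) • c) ⬝ᵥ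
        ((u * x) • a + (u * y) • b + (u * z) • c) = u * u * q := fun u => by
      rw [hq]; simp only [mul_smul, ← smul_add, dotProduct_smul, smul_dotProduct, smul_eq_mul]
      ring
    have hr' : t * t * q = r := by rw [ht2]; field_simp
    have e1 := hcon (t * x) (t * y) (t * z) (by rw [hsc, hr']) (mul_ne_zero ht0.ne' hz)
    have e2 := hcon (-t * x) (-t * y) (-t * z) (by rw [hsc, ← hr']; ring)
      (mul_ne_zero (neg_ne_zero.2 ht0.ne') hz)
    constructor
    · have : t * (x * sa + y * sb + z * sc + (x + y + z) * sv) = 0 := by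
        linear_combination (e1 - e2) / 2
      exact (mul_eq_zero.1 this).resolve_left ht0.ne'
    · linear_combination q * (e1 + e2) / 2 + ((x + y + z) * (x * sa + y * sb + z * sc) +
        (x * y * ηab + y * z * ηbc + x * z * ηac)) * hr'
  obtain ⟨h1, h1'⟩ := key 0 0 1 one_ne_zero
  obtain ⟨h2, h2'⟩ := key 1 0 1 one_ne_zero
  obtain ⟨h3, h3'⟩ := key 0 1 1 one_ne_zero
  obtain ⟨-, h4'⟩ := key 1 1 1 one_ne_zero
  simp only [zero_smul, zero_add, one_smul] at h1'
  -- At (0, 0, 1) the odd part gives sc = -sv and the even part sv (c·c - r) = 0. If sv ≠ 0, then c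
  -- lies on the sphere of v, so sc = sv, a contradiction.
  have hsv : sv = 0 := by
    by_contra h0
    have : c ⬝ᵥ c = r := mul_left_cancel₀ h0 (by linear_combination -h1' - r * h1)
    have := hc this
    apply h0
    linarith
  subst hsv
  have hsc : sc = 0 := by linarith
  have hsa : sa = 0 := by linarith
  have hsb : sb = 0 := by linarith
  subst hsc hsa hsb
  have hac : ηac = 0 := (mul_eq_zero.1 (by linear_combination -h2' : r * ηac = 0)).resolve_left
    hr.ne'
  have hbc : ηbc = 0 := (mul_eq_zero.1 (by linear_combination -h3' : r * ηbc = 0)).resolve_left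
    hr.ne'
  subst hac hbc
  have hab : ηab = 0 := (mul_eq_zero.1 (by linear_combination -h4' : r * ηab = 0)).resolve_left
    hr.ne'
  exact ⟨rfl, rfl, rfl, rfl, hab, rfl, rfl⟩

end GeneralPosition

/-! ### Transfer of non-vanishing conditions to a generic framework -/

section Genericity

variable {V C : Type*} {χ : V → Option C} {D : Finset C} {F : Finset (Sym2 V)}

/-- Coordinates of velocities. -/
def velocityEquiv (V C : Type*) : ((V × Fin 3) ⊕ C → ℝ) ≃ₗ[ℝ] Velocity V C where
  toFun m := (fun v i => m (Sum.inl (v, i)), fun c => m (Sum.inr c))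
  map_add' _ _ := rfl
  map_smul' _ _ := rfl
  invFun m := Sum.elim (fun x => m.1 x.1 x.2) m.2
  left_inv m := by ext (x | c) <;> rfl
  right_inv m := rfl

@[simp] theorem velocityEquiv_fst (m : (V × Fin 3) ⊕ C → ℝ) (v : V) (i : Fin 3) :
    (velocityEquiv V C m).1 v i = m (Sum.inl (v, i)) := rfl

@[simp] theorem velocityEquiv_snd (m : (V × Fin 3) ⊕ C → ℝ) (c : C) :
    (velocityEquiv V C m).2 c = m (Sum.inr c) := rfl

theorem finrank_ker_eq_finrank {ι : Type*} [Fintype ι] [Fintype V] [Fintype C]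
    {A : Matrix ι ((V × Fin 3) ⊕ C) ℝ} {S : Submodule ℝ (Velocity V C)}
    (h : ∀ m, A *ᵥ m = 0 ↔ velocityEquiv V C m ∈ S) :
    finrank ℝ (LinearMap.ker A.mulVecLin) = finrank ℝ S := by
  have h1 : LinearMap.ker A.mulVecLin = S.comap (velocityEquiv V C : _ →ₗ[ℝ] _) := by
    ext m
    rw [LinearMap.mem_ker, mulVecLin_apply, h]
    rfl
  rw [h1]
  exact ((velocityEquiv V C).ofSubmodule' S).finrank_eq

theorem rank_add_finrank {ι : Type*} [Fintype ι] [Fintype V] [Fintype C]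
    {A : Matrix ι ((V × Fin 3) ⊕ C) ℝ} {S : Submodule ℝ (Velocity V C)}
    (h : ∀ m, A *ᵥ m = 0 ↔ velocityEquiv V C m ∈ S) :
    A.rank + finrank ℝ S = 3 * Fintype.card V + Fintype.card C := by
  have h1 := LinearMap.finrank_range_add_finrank_ker A.mulVecLin
  rw [finrank_ker_eq_finrank h] at h1
  rw [Matrix.rank, h1]
  simp [mul_comm]

theorem isUnit_of_rank_eq_card {ι : Type*} [Fintype ι] [DecidableEq ι] {A : Matrix ι ι ℝ}
    (h : A.rank = Fintype.card ι) : IsUnit A := by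
  rw [← mulVec_surjective_iff_isUnit]
  have h1 : LinearMap.range A.mulVecLin = ⊤ :=
    Submodule.eq_top_of_finrank_eq (by rw [finrank_pi]; exact h)
  exact LinearMap.range_eq_top.1 h1

/-- The matrix whose kernel is the space of motions. -/
def motionMatrix [DecidableEq V] [DecidableEq C] {R : Type*} [CommRing R] (χ : V → Option C)
    (p : V × Fin 3 → R) (D : Finset C) (F : Finset (Sym2 V)) :
    Matrix (F ⊕ (V ⊕ {c // c ∉ D})) ((V × Fin 3) ⊕ C) R
  -- `out` chooses an order of the two ends; the opposite order changes both signs and gives the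
  -- same row.
  | Sum.inl e, Sum.inl (v, i) => (p (e.1.out.1, i) - p (e.1.out.2, i)) *
      ((if v = e.1.out.1 then 1 else 0) - if v = e.1.out.2 then 1 else 0)
  | Sum.inl _, Sum.inr _ => 0
  | Sum.inr (Sum.inl v), Sum.inl (w, i) => if w = v then p (v, i) else 0
  | Sum.inr (Sum.inl v), Sum.inr c => if χ v = some c then 1 else 0
  | Sum.inr (Sum.inr _), Sum.inl _ => 0
  | Sum.inr (Sum.inr d), Sum.inr c => if c = d.1 then 1 else 0

theorem motionMatrix_map [DecidableEq V] [DecidableEq C] {R S : Type*} [CommRing R] [CommRing S]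
    (f : R →+* S) (p : V × Fin 3 → R) :
    (motionMatrix χ p D F).map f = motionMatrix χ (fun x => f (p x)) D F := by
  ext (e | v | d) (⟨w, i⟩ | c) <;> simp only [map_apply, motionMatrix] <;>
    (try split_ifs) <;> simp

section

variable [Fintype V] [Fintype C] [DecidableEq V] [DecidableEq C]

omit [Fintype V] in
theorem sum_ite_eq_speed (σ : C → ℝ) (o : Option C) :
    ∑ c, (if o = some c then 1 else 0) * σ c = speed σ o := by
  cases o <;> simp

theorem motionMatrix_mulVec_eq_zero (p : V × Fin 3 → ℝ) (m : (V × Fin 3) ⊕ C → ℝ) :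
    motionMatrix χ p D F *ᵥ m = 0 ↔
      velocityEquiv V C m ∈ motions χ (fun v i => p (v, i)) D F := by
  have h1 : ∀ e : F, (motionMatrix χ p D F *ᵥ m) (Sum.inl e) =
      strain C (fun v i => p (v, i)) e.1.out.1 e.1.out.2 (velocityEquiv V C m) := fun e => by
    simp only [mulVec, dotProduct, Fintype.sum_sum_type, motionMatrix, zero_mul,
      Finset.sum_const_zero, add_zero, strain_apply, velocityEquiv_fst, Fintype.sum_prod_type,
      Pi.sub_apply]
    rw [Finset.sum_comm]
    refine Finset.sum_congr rfl fun i _ => ?_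
    simp only [mul_sub, sub_mul, mul_ite, mul_one, mul_zero, ite_mul, zero_mul,
      Finset.sum_sub_distrib, Finset.sum_ite_eq', Finset.mem_univ, if_true]
  have h2 : ∀ v : V, (motionMatrix χ p D F *ᵥ m) (Sum.inr (Sum.inl v)) =
      (fun i => p (v, i)) ⬝ᵥ (velocityEquiv V C m).1 v + speed (velocityEquiv V C m).2 (χ v) :=
    fun v => by
      rw [← sum_ite_eq_speed]
      simp only [mulVec, dotProduct, Fintype.sum_sum_type, motionMatrix, velocityEquiv_fst,
        velocityEquiv_snd, Fintype.sum_prod_type]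
      congr 1
      rw [Finset.sum_comm]
      simp
  have h3 : ∀ d : {c // c ∉ D}, (motionMatrix χ p D F *ᵥ m) (Sum.inr (Sum.inr d)) =
      (velocityEquiv V C m).2 d := fun d => by
    simp [mulVec, dotProduct, motionMatrix]
  rw [mem_motions, _root_.funext_iff]
  constructor
  · intro h
    refine ⟨fun u w huw => ?_, fun v => by rw [← h2, h]; rfl, fun c hc => by
      rw [← h3 ⟨c, hc⟩, h]; rfl⟩
    have h4 := (h1 ⟨_, huw⟩).symm.trans (h (Sum.inl ⟨_, huw⟩))
    have h5 : s((s(u, w)).out.1, (s(u, w)).out.2) = s(u, w) := Quot.out_eq _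
    rcases Sym2.eq_iff.1 h5 with ⟨h6, h7⟩ | ⟨h6, h7⟩
    · rwa [h6, h7] at h4
    · rwa [h6, h7, strain_comm] at h4
  · rintro ⟨g1, g2, g3⟩ (e | v | d)
    · rw [h1]
      refine g1 _ _ ?_
      have h5 : s(e.1.out.1, e.1.out.2) = e.1 := Quot.out_eq _
      rw [h5]
      exact e.2
    · rw [h2]; exact g2 v
    · rw [h3]; exact g3 _ d.2

theorem rank_motionMatrix {p : V → Fin 3 → ℝ} (hp : ∀ v, p v ≠ 0) :
    (motionMatrix χ (fun x => p x.1 x.2) D F).rank + D.card =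
      Fintype.card V + Fintype.card C + rk χ p D F := by
  have h1 := rank_add_finrank (motionMatrix_mulVec_eq_zero (χ := χ) (D := D) (F := F)
    (fun x => p x.1 x.2))
  have h2 := rk_add_finrank (χ := χ) (p := p) (D := D) (F := F)
  rw [finrank_motions_empty hp] at h2
  have h3 : finrank ℝ (motions χ (fun v i => p v i) D F) = finrank ℝ (motions χ p D F) := rfl
  simp only [h3] at h1
  omega

/-- Independence of F means full row rank of the motion matrix, that is, a nonzero Gram determinant
over ℝ. This turns it into the non-vanishing of one rational polynomial. -/
theorem rk_eq_card_iff {p : V → Fin 3 → ℝ} (hp : ∀ v, p v ≠ 0) :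
    rk χ p D F = F.card ↔
      (motionMatrix χ (fun x => p x.1 x.2) D F * (motionMatrix χ (fun x => p x.1 x.2) D F)ᵀ).det
        ≠ 0 := by
  have h1 := rank_motionMatrix (χ := χ) (D := D) (F := F) hp
  have h2 := Finset.card_le_univ D
  have h3 : Fintype.card (F ⊕ (V ⊕ {c // c ∉ D})) =
      F.card + (Fintype.card V + (Fintype.card C - D.card)) := by
    simp [Fintype.card_subtype_compl]
  rw [← rank_self_mul_transpose] at h1
  constructor
  · intro h
    have := isUnit_of_rank_eq_card (A := motionMatrix χ (fun x => p x.1 x.2) D F *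
      (motionMatrix χ (fun x => p x.1 x.2) D F)ᵀ) (by omega)
    exact ((isUnit_iff_isUnit_det _).1 this).ne_zero
  · intro h
    have := rank_of_det_ne_zero h
    omega

end

/-- Positions and radii form a point of the variety defined by the sphere polynomials. -/
def OnSpheres (χ : V → Option C) (q : V → Fin 3 → ℝ) (s : C → ℝ) : Prop :=
  ∀ v, q v ⬝ᵥ q v = radius s (χ v) ^ 2

variable {P : Framework 2 χ}

/-- The positions of a framework as functions. -/
def Framework.pos (P : Framework 2 χ) (v : V) : Fin 3 → ℝ := fun i => P.p v i

theorem Framework.onSpheres (P : Framework 2 χ) : OnSpheres χ P.pos P.r := fun v => by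
  have h := P.mem_sphere v
  rw [mem_sphere_zero_iff_norm] at h
  rw [← h, EuclideanSpace.real_norm_sq_eq]
  exact Finset.sum_congr rfl fun i _ => (sq _).symm

theorem Framework.radius_pos (P : Framework 2 χ) (o : Option C) : 0 < radius P.r o := by
  cases o
  · exact one_pos
  · exact P.r_pos _

theorem Framework.pos_ne_zero (P : Framework 2 χ) (v : V) : P.pos v ≠ 0 := fun h => by
  have h1 := P.onSpheres v
  rw [h, zero_dotProduct] at h1
  exact (pow_pos (P.radius_pos (χ v)) 2).ne h1

/-- Evaluation of polynomials at positions and radii. -/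
def evalAt (q : V → Fin 3 → ℝ) (s : C → ℝ) : MvPolynomial ((V × Fin 3) ⊕ C) ℚ →ₐ[ℚ] ℝ :=
  aeval (Sum.elim (fun x => q x.1 x.2) s)

/-- The form in which genericity is used: one test point of the variety suffices. Members of the
ideal of the sphere polynomials vanish at every such point. -/
theorem Framework.IsGeneric.evalAt_ne_zero (hP : P.IsGeneric) {q : V → Fin 3 → ℝ} {s : C → ℝ}
    (hq : OnSpheres χ q s) {f : MvPolynomial ((V × Fin 3) ⊕ C) ℚ} (hf : evalAt q s f ≠ 0) :
    evalAt P.pos P.r f ≠ 0 := by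
  intro h
  have h1 := hP f h
  refine hf ?_
  have h2 : Ideal.span (Set.range (spherePoly (d := 2) χ)) ≤ RingHom.ker (evalAt q s) := by
    rw [Ideal.span_le]
    rintro _ ⟨v, rfl⟩
    rw [SetLike.mem_coe, RingHom.mem_ker]
    have h3 := hq v
    have h4 : evalAt q s (radiusSqPoly V 2 (χ v)) = radius s (χ v) ^ 2 := by
      rcases χ v with _ | c <;> simp [evalAt, radiusSqPoly, radius]
    rw [spherePoly, map_sub, h4, ← h3, sub_eq_zero, map_sum]
    refine Finset.sum_congr rfl fun i _ => ?_
    rw [map_pow, sq]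
    simp [evalAt]
  exact RingHom.mem_ker.1 (h2 h1)

theorem Framework.IsGeneric.rk_eq_card [Fintype V] [Fintype C] (hP : P.IsGeneric)
    {q : V → Fin 3 → ℝ} (hq : OnSpheres χ q P.r) (hF : rk χ q D F = F.card) :
    rk χ P.pos D F = F.card := by
  classical
  have hq0 : ∀ v, q v ≠ 0 := fun v h => by
    have h1 := hq v
    rw [h, zero_dotProduct] at h1
    exact (pow_pos (P.radius_pos (χ v)) 2).ne h1
  rw [rk_eq_card_iff hq0] at hF
  rw [rk_eq_card_iff P.pos_ne_zero]
  let A := motionMatrix χ (fun x => (X (Sum.inl x) : MvPolynomial ((V × Fin 3) ⊕ C) ℚ)) D F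
  have key : ∀ q : V → Fin 3 → ℝ, evalAt q P.r (A * Aᵀ).det =
      (motionMatrix χ (fun x => q x.1 x.2) D F *
        (motionMatrix χ (fun x => q x.1 x.2) D F)ᵀ).det := fun q => by
    have h1 : A.map (evalAt q P.r).toRingHom = motionMatrix χ (fun x => q x.1 x.2) D F := by
      have := motionMatrix_map (χ := χ) (D := D) (F := F) (evalAt q P.r).toRingHom
        (fun x => X (Sum.inl x))
      simpa [evalAt] using this
    rw [← h1, ← transpose_map, ← Matrix.map_mul]
    exact RingHom.map_det (evalAt q P.r).toRingHom _
  rw [← key] at hF ⊢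
  exact hP.evalAt_ne_zero hq hF

/-- Needed in the degree-three step: a neighbour that lies on the sphere of v has the colour of v.
-/
theorem Framework.IsGeneric.radius_injective (hP : P.IsGeneric) {o o' : Option C}
    (h : radius P.r o ^ 2 = radius P.r o' ^ 2) : o = o' := by
  classical
  let f : Option C → MvPolynomial ((V × Fin 3) ⊕ C) ℚ := fun o => o.elim 1 fun c => X (Sum.inr c)
  have hf : ∀ (q : V → Fin 3 → ℝ) s o, evalAt q s (f o) = radius s o := by
    intro q s o
    cases o <;> simp [f, evalAt, radius]
  rw [pow_left_inj₀ (P.radius_pos o).le (P.radius_pos o').le two_ne_zero] at h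
  by_contra hne
  have key : ∃ s : C → ℝ, radius s o ≠ radius s o' := by
    rcases o with _ | c
    · rcases o' with _ | c'
      · exact (hne rfl).elim
      · exact ⟨fun _ => 2, by norm_num [radius]⟩
    · refine ⟨fun d => if d = c then 2 else 1, ?_⟩
      rcases o' with _ | c'
      · norm_num [radius]
      · have : c' ≠ c := fun h => hne (by rw [h])
        norm_num [radius, this]
  obtain ⟨s, hs⟩ := key
  have hq : OnSpheres χ (fun v => ![radius s (χ v), 0, 0]) s := fun v => by
    simp [sq]
  refine hP.evalAt_ne_zero hq (f := f o - f o') ?_ ?_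
  · rwa [map_sub, hf, hf, sub_ne_zero]
  · rw [map_sub, hf, hf, h, sub_self]

theorem Framework.IsGeneric.triple_ne_zero (hP : P.IsGeneric) {a b c : V} (hab : a ≠ b)
    (hbc : b ≠ c) (hac : a ≠ c) : P.pos a ⬝ᵥ P.pos b ⨯₃ P.pos c ≠ 0 := by
  classical
  let x : V → Fin 3 → MvPolynomial ((V × Fin 3) ⊕ C) ℚ := fun v i => X (Sum.inl (v, i))
  have hx : ∀ (q : V → Fin 3 → ℝ) s v i, evalAt q s (x v i) = q v i := fun q s v i => by
    simp [evalAt, x]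
  have hf : ∀ (q : V → Fin 3 → ℝ) s,
      evalAt q s (x a ⬝ᵥ x b ⨯₃ x c) = q a ⬝ᵥ q b ⨯₃ q c := fun q s => by
    simp only [cross_apply, vec3_dotProduct, cons_val, map_add, map_mul, map_sub, hx]
  -- The test point puts a, b, c on three orthogonal axes.
  have hq : OnSpheres χ (fun v => radius P.r (χ v) •
      if v = a then ![1, 0, 0] else if v = b then ![0, 1, 0] else ![0, 0, 1]) P.r := fun v => by
    dsimp only
    split_ifs <;> simp [sq]
  rw [← hf _ P.r]
  refine hP.evalAt_ne_zero hq ?_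
  rw [hf]
  simp [cross_apply, hab.symm, hbc.symm, hac.symm, (P.radius_pos _).ne']

theorem Framework.IsGeneric.cross_ne_zero (hP : P.IsGeneric) {a b : V} (hab : a ≠ b) :
    P.pos a ⨯₃ P.pos b ≠ 0 := by
  classical
  let x : V → Fin 3 → MvPolynomial ((V × Fin 3) ⊕ C) ℚ := fun v i => X (Sum.inl (v, i))
  have hf : ∀ (q : V → Fin 3 → ℝ) s,
      evalAt q s ((x a ⨯₃ x b) 2) = (q a ⨯₃ q b) 2 := fun q s => by
    simp [cross_apply, evalAt, x]
  have hq : OnSpheres χ (fun v => radius P.r (χ v) •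
      if v = a then ![1, 0, 0] else ![0, 1, 0]) P.r := fun v => by
    dsimp only
    split_ifs <;> simp [sq]
  intro h
  refine hP.evalAt_ne_zero hq (f := (x a ⨯₃ x b) 2) ?_ ?_
  · rw [hf]
    simp [cross_apply, hab.symm, (P.radius_pos _).ne']
  · rw [hf, h]; rfl

end Genericity

/-! ### The rank of the rigidity matrix and the addition of a vertex of degree three -/

section Extension

variable {V C : Type*} {χ : V → Option C} {D : Finset C} {F : Finset (Sym2 V)}

theorem rigidityMatrix_inl_inl [DecidableEq V] [DecidableEq C] {G : SimpleGraph V}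
    (p : V → EuclideanSpace ℝ (Fin 3)) {u w : V} (huw : u ≠ w) (h : s(u, w) ∈ G.edgeSet) (x : V)
    (i : Fin 3) : rigidityMatrix (d := 2) G χ p (Sum.inl ⟨s(u, w), h⟩) (Sum.inl (x, i)) =
      (p u i - p w i) * ((if x = u then 1 else 0) - if x = w then 1 else 0) := by
  simp only [rigidityMatrix]
  by_cases h1 : x ∈ s(u, w)
  · rw [dif_pos h1]
    rcases Sym2.mem_iff.1 h1 with rfl | rfl
    · have h4 : Sym2.Mem.other h1 = w := Sym2.congr_right.1 (Sym2.other_spec h1)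
      rw [h4, if_pos rfl, if_neg huw]; ring
    · have h4 : Sym2.Mem.other h1 = u :=
        Sym2.congr_right.1 ((Sym2.other_spec h1).trans Sym2.eq_swap)
      rw [h4, if_pos rfl, if_neg huw.symm]; ring
  · rw [dif_neg h1]
    rw [Sym2.mem_iff, not_or] at h1
    rw [if_neg h1.1, if_neg h1.2]; ring

/-- The kernel is the space of motions with all radii free. There are 3|V| + |C| columns, and
without edges this space has dimension 2|V| + |C|; the difference is |V|. -/
theorem rank_rigidityMatrix [Fintype V] [Fintype C] [DecidableEq V] [DecidableEq C]
    (G : SimpleGraph V) (P : Framework 2 χ) {E : Finset (Sym2 V)} (hE : ∀ e, e ∈ E ↔ e ∈ G.edgeSet) :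
    (rigidityMatrix G χ P.p).rank = Fintype.card V + rk χ P.pos Finset.univ E := by
  have hker : ∀ m, rigidityMatrix G χ P.p *ᵥ m = 0 ↔
      velocityEquiv V C m ∈ motions χ P.pos Finset.univ E := by
    intro m
    have h1 : ∀ u w (h : s(u, w) ∈ G.edgeSet), (rigidityMatrix G χ P.p *ᵥ m) (Sum.inl ⟨_, h⟩) =
        strain C P.pos u w (velocityEquiv V C m) := fun u w h => by
      have huw : u ≠ w := G.ne_of_adj h
      simp only [mulVec, dotProduct, Fintype.sum_sum_type, Fintype.sum_prod_type,
        rigidityMatrix_inl_inl P.p huw h, strain_apply, velocityEquiv_fst, Pi.sub_apply]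
      have h0 : ∀ c, rigidityMatrix G χ P.p (Sum.inl ⟨_, h⟩) (Sum.inr c) = 0 := fun c => rfl
      simp only [h0, zero_mul, Finset.sum_const_zero, add_zero]
      rw [Finset.sum_comm]
      refine Finset.sum_congr rfl fun i _ => ?_
      simp only [mul_sub, sub_mul, mul_ite, mul_one, mul_zero, ite_mul, zero_mul,
        Finset.sum_sub_distrib, Finset.sum_ite_eq', Finset.mem_univ, if_true, Framework.pos]
    have h2 : ∀ v : V, (rigidityMatrix G χ P.p *ᵥ m) (Sum.inr v) =
        P.pos v ⬝ᵥ (velocityEquiv V C m).1 v + speed (velocityEquiv V C m).2 (χ v) := fun v => by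
      rw [← sum_ite_eq_speed]
      simp only [mulVec, dotProduct, Fintype.sum_sum_type, rigidityMatrix, velocityEquiv_fst,
        velocityEquiv_snd, Fintype.sum_prod_type]
      congr 1
      rw [Finset.sum_comm]
      simp [Framework.pos]
    rw [mem_motions, _root_.funext_iff]
    constructor
    · intro h
      refine ⟨fun u w huw => ?_, fun v => by rw [← h2, h]; rfl, by simp⟩
      rw [← h1 u w ((hE _).1 huw), h]; rfl
    · rintro ⟨g1, g2, -⟩ (⟨e, he⟩ | v)
      · induction e with | _ u w => ?_
        rw [h1]
        exact g1 _ _ ((hE _).2 he)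
      · rw [h2]; exact g2 v
  classical
  have h1 := rank_add_finrank hker
  have h2 := rk_add_finrank (χ := χ) (p := P.pos) (D := Finset.univ) (F := E)
  rw [finrank_motions_empty P.pos_ne_zero, Finset.card_univ] at h2
  omega

/-- Cramer's rule, with the dual basis written by cross products. -/
theorem exists_dotProduct_eq {u v w : Fin 3 → ℝ} (h : u ⬝ᵥ v ⨯₃ w ≠ 0) (α β γ : ℝ) :
    ∃ y, u ⬝ᵥ y = α ∧ v ⬝ᵥ y = β ∧ w ⬝ᵥ y = γ := by
  refine ⟨(u ⬝ᵥ v ⨯₃ w)⁻¹ • (α • (v ⨯₃ w) + β • (w ⨯₃ u) + γ • (u ⨯₃ v)), ?_, ?_, ?_⟩ <;>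
    simp only [dotProduct_smul, dotProduct_add, dot_self_cross, dot_cross_self, smul_eq_mul,
      mul_zero, add_zero, zero_add]
  · field_simp
  · rw [triple_product_permutation v w u, triple_product_permutation w u v]; field_simp
  · rw [triple_product_permutation w u v]; field_simp

section

variable [DecidableEq V]

theorem update_mem_motions {p q : V → Fin 3 → ℝ} {m : Velocity V C} {v : V} {y : Fin 3 → ℝ}
    (hm : m ∈ motions χ p D F) (hpq : ∀ w, w ≠ v → q w = p w) (hF : ∀ e ∈ F, v ∉ e)
    (hy : q v ⬝ᵥ y + speed m.2 (χ v) = 0) :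
    ((Function.update m.1 v y, m.2) : Velocity V C) ∈ motions χ q D F := by
  refine ⟨fun u w h => ?_, fun u => ?_, hm.2.2⟩
  · have hu : u ≠ v := fun hu => hF _ h (hu ▸ Sym2.mem_mk_left u w)
    have hw : w ≠ v := fun hu => hF _ h (hu ▸ Sym2.mem_mk_right u w)
    have := hm.1 u w h
    rw [strain_apply] at this ⊢
    simpa [hu, hw, hpq] using this
  · rcases eq_or_ne u v with rfl | h
    · simpa using hy
    · simpa [h, hpq u h] using hm.2.1 u

/-- Moving a vertex that F avoids loses no rank: every motion survives once that vertex gets a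
radial velocity matching the speed of its sphere. -/
theorem rk_le_rk_of_forall_ne [Fintype V] [Fintype C] {p q : V → Fin 3 → ℝ} {v : V}
    (hq : q v ≠ 0) (hpq : ∀ w, w ≠ v → q w = p w) (hF : ∀ e ∈ F, v ∉ e) :
    rk χ p D F ≤ rk χ q D F := by
  induction F using Finset.induction_on with
  | empty => simp [rk_empty]
  | insert e F he ih =>
    have hF' : ∀ e ∈ F, v ∉ e := fun e he => hF e (Finset.mem_insert_of_mem he)
    have ih := ih hF'
    have hve := hF e (Finset.mem_insert_self _ _)
    induction e with | _ u w => ?_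
    by_cases h : ∃ m ∈ motions χ p D F, strain C p u w m ≠ 0
    · obtain ⟨m, hm, hs⟩ := h
      have hq0 : q v ⬝ᵥ q v ≠ 0 := fun h => hq (dotProduct_self_eq_zero.1 h)
      have hm' := update_mem_motions (y := -(speed m.2 (χ v) * (q v ⬝ᵥ q v)⁻¹) • q v) hm hpq hF'
        (by rw [dotProduct_smul, smul_eq_mul]; field_simp; ring)
      have hu : u ≠ v := fun hu => hve (hu ▸ Sym2.mem_mk_left u w)
      have hw : w ≠ v := fun hu => hve (hu ▸ Sym2.mem_mk_right u w)
      rw [rk_insert hm hs, rk_insert hm']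
      · exact Nat.add_le_add_right ih 1
      · rw [strain_apply] at hs ⊢
        simpa [hu, hw, hpq] using hs
    · push Not at h
      have h2 : rk χ p D (insert s(u, w) F) = rk χ p D F := by
        rw [rk, rk, motions_insert_eq_self h]
      rw [h2]
      exact ih.trans (rk_mono (Finset.subset_insert _ _))

end

variable [Fintype V] [Fintype C] [DecidableEq V] {P : Framework 2 χ}

/-- Adding a vertex of degree three. -/
theorem Framework.IsGeneric.rk_insert_three (hP : P.IsGeneric) {v a b c : V} (hav : a ≠ v)
    (hbv : b ≠ v) (hcv : c ≠ v) (hab : a ≠ b) (hbc : b ≠ c) (hac : a ≠ c)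
    (hF : ∀ e ∈ F, v ∉ e) (hcard : rk χ P.pos D F = F.card) {m : Velocity V C}
    (hm : m ∈ motions χ P.pos D F)
    (hne : ¬ (speed m.2 (χ v) = 0 ∧ speed m.2 (χ a) = 0 ∧ speed m.2 (χ b) = 0 ∧
      speed m.2 (χ c) = 0 ∧ strain C P.pos a b m = 0 ∧ strain C P.pos b c m = 0 ∧
      strain C P.pos a c m = 0)) :
    rk χ P.pos D (insert s(v, c) (insert s(v, b) (insert s(v, a) F))) = F.card + 3 := by
  -- The vertex v is moved to a point of its own sphere where the obstruction is nonzero; z ≠ 0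
  -- keeps it independent of a and b.
  obtain ⟨x, y, z, hsph, hz, hΦ⟩ := exists_extension_obstruction_ne_zero
    (hP.triple_ne_zero hab hbc hac) (pow_pos (P.radius_pos (χ v)) 2)
    (fun h => by rw [P.onSpheres c] at h; rw [hP.radius_injective h]) hne
  set y0 := x • P.pos a + y • P.pos b + z • P.pos c with hy0
  let q := Function.update P.pos v y0
  have hqv : q v = y0 := Function.update_self _ _ _
  have hq : ∀ w, w ≠ v → q w = P.pos w := fun w hw => Function.update_of_ne hw _ _
  have hsq : OnSpheres χ q P.r := fun w => by
    rcases eq_or_ne w v with rfl | h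
    · rw [hqv, hsph]
    · rw [hq w h, P.onSpheres]
  have hq0 : ∀ w, q w ≠ 0 := fun w h => by
    have h1 := hsq w
    rw [h, zero_dotProduct] at h1
    exact (pow_pos (P.radius_pos (χ w)) 2).ne h1
  have hdet : q v ⬝ᵥ q a ⨯₃ q b ≠ 0 := by
    rw [hqv, hq a hav, hq b hbv, hy0]
    simp only [add_dotProduct, smul_dotProduct, dot_self_cross, dot_cross_self, smul_eq_mul,
      mul_zero, zero_add]
    rw [triple_product_permutation]
    exact mul_ne_zero hz (hP.triple_ne_zero hab hbc hac)
  -- The velocity of v is fixed by the sphere condition and zero strain on va and vb; the nonzero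
  -- obstruction then forces a strain on vc.
  obtain ⟨v', hv1, hv2, hv3⟩ := exists_dotProduct_eq hdet (-speed m.2 (χ v))
    (-speed m.2 (χ v) - (q v - q a) ⬝ᵥ m.1 a) (-speed m.2 (χ v) - (q v - q b) ⬝ᵥ m.1 b)
  have hm' := update_mem_motions (y := v') hm hq hF (by rw [hv1]; ring)
  set m' : Velocity V C := (Function.update m.1 v v', m.2) with hm'_def
  have hva : strain C q v a m' = 0 := by
    simp only [strain_apply, hm'_def, Function.update_self, Function.update_of_ne hav]
    rw [dotProduct_sub, sub_dotProduct (q v) (q a) v', hv1, hv2]; ring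
  have hvb : strain C q v b m' = 0 := by
    simp only [strain_apply, hm'_def, Function.update_self, Function.update_of_ne hbv]
    rw [dotProduct_sub, sub_dotProduct (q v) (q b) v', hv1, hv3]; ring
  have hvc : strain C q v c m' ≠ 0 := fun h => hΦ (by
    simp only [strain_apply, hm'_def, Function.update_self, Function.update_of_ne hav,
      Function.update_of_ne hbv, Function.update_of_ne hcv, hqv, hq a hav, hq b hbv,
      hq c hcv] at hva hvb h
    refine extension_obstruction hy0 ?_ (hm.2.1 a) (hm.2.1 b) (hm.2.1 c) hva hvb h
    rw [← hqv, hv1]; ring)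
  have h1 : rk χ q D (insert s(v, b) (insert s(v, a) F)) = rk χ q D F + 2 :=
    rk_insert_insert_of_notMem hav hbv hdet hF
  have h2 : rk χ q D (insert s(v, c) (insert s(v, b) (insert s(v, a) F))) = rk χ q D F + 3 := by
    rw [rk_insert (m := m') ?_ hvc, h1]
    rw [motions_insert, motions_insert]
    exact ⟨⟨hm', LinearMap.mem_ker.2 hva⟩, LinearMap.mem_ker.2 hvb⟩
  have h3 : rk χ P.pos D F ≤ rk χ q D F := rk_le_rk_of_forall_ne (hq0 v) hq hF
  have h4 : rk χ q D F ≤ F.card := rk_le_card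
  have h5 : (insert s(v, c) (insert s(v, b) (insert s(v, a) F))).card = F.card + 3 := by
    have hFv : ∀ w, s(v, w) ∉ F := fun w hw => hF _ hw (Sym2.mem_mk_left v w)
    rw [Finset.card_insert_of_notMem, Finset.card_insert_of_notMem,
      Finset.card_insert_of_notMem (hFv a)]
    · simp [hFv, hab.symm, hbv]
    · simp [hFv, hbc.symm, hac.symm, hcv]
  rw [← h5]
  -- All edges are independent at the special position, hence also at the generic one.
  exact hP.rk_eq_card hsq (by omega)

end Extension

/-! ### Edmonds' formula and vertices of small degree -/

section Combinatorics

/-- Edmonds' rank formula for the independent sets of an integral polymatroid. -/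
theorem exists_indep_card_ge {α : Type*} [DecidableEq α] {f : Finset α → ℕ}
    (hmono : ∀ {S T}, S ⊆ T → f S ≤ f T) (hsub : ∀ S T, f (S ∪ T) + f (S ∩ T) ≤ f S + f T)
    (hzero : f ∅ = 0) (E : Finset α) : ∃ F ⊆ E, (∀ T ⊆ F, T.card ≤ f T) ∧
      ∃ T ⊆ E, (E \ T).card + f T ≤ F.card := by
  classical
  let I := E.powerset.filter fun F => ∀ T ⊆ F, T.card ≤ f T
  have hI : ∀ F, F ∈ I ↔ F ⊆ E ∧ ∀ T ⊆ F, T.card ≤ f T := fun F => by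
    simp [I, Finset.mem_powerset]
  obtain ⟨F, hF, hFmax⟩ := I.exists_max_image Finset.card ⟨∅, (hI _).2 ⟨Finset.empty_subset _,
    fun T hT => by simp [Finset.subset_empty.1 hT]⟩⟩
  rw [hI] at hF
  obtain ⟨hFE, hind⟩ := hF
  let J := F.powerset.filter fun T => f T = T.card
  have hJ : ∀ T, T ∈ J ↔ T ⊆ F ∧ f T = T.card := fun T => by simp [J, Finset.mem_powerset]
  obtain ⟨T, hT, hTmax⟩ := J.exists_max_image Finset.card ⟨∅, (hJ _).2 ⟨Finset.empty_subset _,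
    by simp [hzero]⟩⟩
  rw [hJ] at hT
  -- By submodularity the sets with f S = |S| are closed under union, so T, one of maximal size,
  -- contains them all.
  have hsup : ∀ S ⊆ F, f S = S.card → S ⊆ T := by
    intro S hS hSt
    have h1 := hsub S T
    have h2 := Finset.card_union_add_card_inter S T
    have h3 := hind (S ∪ T) (Finset.union_subset hS hT.1)
    have h4 := hind (S ∩ T) (Finset.inter_subset_left.trans hS)
    have h5 := hTmax (S ∪ T) ((hJ _).2 ⟨Finset.union_subset hS hT.1, by have := hT.2; omega⟩)
    have h6 : T = S ∪ T := Finset.eq_of_subset_of_card_le Finset.subset_union_right h5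
    rw [h6]
    exact Finset.subset_union_left
  -- Maximality of F gives a violated set S containing e. Then S - e is tight and so inside T, and e
  -- adds nothing to S - e, hence nothing to T.
  have hins : ∀ e ∈ E \ F, f (insert e T) ≤ f T := by
    intro e he
    rw [Finset.mem_sdiff] at he
    have h1 : insert e F ∉ I := fun h => by
      have := hFmax _ h
      rw [Finset.card_insert_of_notMem he.2] at this
      omega
    rw [hI, not_and] at h1
    have h2 := h1 (Finset.insert_subset he.1 hFE)
    push Not at h2
    obtain ⟨S, hS, hlt⟩ := h2
    have heS : e ∈ S := by
      by_contra h
      have := hind S fun x hx => (Finset.mem_insert.1 (hS hx)).resolve_left fun h' => h (h' ▸ hx)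
      omega
    have hS' : S.erase e ⊆ F := fun x hx =>
      (Finset.mem_insert.1 (hS (Finset.mem_of_mem_erase hx))).resolve_left
        (Finset.ne_of_mem_erase hx)
    have h3 := hind _ hS'
    have h4 := Finset.card_erase_add_one heS
    have h5 := hmono (Finset.erase_subset e S)
    have h6 := hsup _ hS' (by omega)
    have h7 := hsub S T
    have h8 : f (S.erase e) ≤ f (S ∩ T) :=
      hmono (Finset.subset_inter (Finset.erase_subset e S) h6)
    have h9 : f (insert e T) ≤ f (S ∪ T) :=
      hmono (Finset.insert_subset (Finset.mem_union_left _ heS) Finset.subset_union_right)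
    omega
  have hall : ∀ A ⊆ E \ F, f (T ∪ A) ≤ f T := by
    intro A
    induction A using Finset.induction_on with
    | empty => simp
    | insert e A he ih =>
      intro hA
      have h1 := hins e (hA (Finset.mem_insert_self _ _))
      have h2 := ih ((Finset.subset_insert _ _).trans hA)
      have h3 := hsub (T ∪ A) (insert e T)
      have h4 : f T ≤ f ((T ∪ A) ∩ insert e T) :=
        hmono (Finset.subset_inter Finset.subset_union_left (Finset.subset_insert _ _))
      have h5 : f (T ∪ insert e A) ≤ f (T ∪ A ∪ insert e T) := hmono (by
        intro x; simp only [Finset.mem_union, Finset.mem_insert]; tauto)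
      omega
  refine ⟨F, hFE, hind, T ∪ (E \ F), Finset.union_subset (hT.1.trans hFE) Finset.sdiff_subset, ?_⟩
  have h1 := hall _ subset_rfl
  have h2 : E \ (T ∪ (E \ F)) ⊆ F \ T := by
    intro x; simp only [Finset.mem_sdiff, Finset.mem_union]; tauto
  have h3 := Finset.card_le_card h2
  have h4 := Finset.card_sdiff_add_card_eq_card hT.1
  have := hT.2
  omega

variable {V C : Type*}

open Classical in
/-- The edges of `F` with both ends in `U`. -/
def inducedEdges (F : Finset (Sym2 V)) (U : Finset V) : Finset (Sym2 V) :=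
  F.filter fun e => ∀ v ∈ e, v ∈ U

open Classical in
/-- The edges of `F` that avoid `v`. -/
def edgesAvoiding (F : Finset (Sym2 V)) (v : V) : Finset (Sym2 V) := F.filter fun e => v ∉ e

variable {F : Finset (Sym2 V)} {U W : Finset V} {v : V} {e : Sym2 V}

theorem mem_inducedEdges : e ∈ inducedEdges F U ↔ e ∈ F ∧ ∀ v ∈ e, v ∈ U := by
  simp [inducedEdges]

theorem mem_edgesAvoiding : e ∈ edgesAvoiding F v ↔ e ∈ F ∧ v ∉ e := by simp [edgesAvoiding]

theorem edgesAvoiding_subset : edgesAvoiding F v ⊆ F := fun _ h => (mem_edgesAvoiding.1 h).1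

theorem notMem_of_mem_edgesAvoiding : ∀ e ∈ edgesAvoiding F v, v ∉ e :=
  fun _ h => (mem_edgesAvoiding.1 h).2

theorem inducedEdges_eq_self (h : ∀ e ∈ F, ∀ v ∈ e, v ∈ U) : inducedEdges F U = F := by
  ext e
  rw [mem_inducedEdges]
  exact ⟨fun h => h.1, fun he => ⟨he, h e he⟩⟩

theorem exists_ne_of_not_isDiag (he : ¬ e.IsDiag) : ∃ u w, u ≠ w ∧ e = s(u, w) := by
  induction e with | _ u w => exact ⟨u, w, fun h => he (Sym2.mk_isDiag_iff.2 h), rfl⟩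

theorem two_le_card_of_forall_mem (he : ¬ e.IsDiag) (h : ∀ v ∈ e, v ∈ U) : 2 ≤ U.card := by
  classical
  obtain ⟨u, w, huw, rfl⟩ := exists_ne_of_not_isDiag he
  rw [← Finset.card_pair huw]
  refine Finset.card_le_card ?_
  simp only [Sym2.mem_iff, forall_eq_or_imp, forall_eq] at h
  simp [Finset.insert_subset_iff, h]

/-- Degrees of at least 4 throughout W would give 4|W| ≤ 2|F|. -/
theorem exists_card_incident_le_three (hnd : ∀ e ∈ F, ¬ e.IsDiag) (hW : ∀ e ∈ F, ∀ v ∈ e, v ∈ W)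
    (hcard : F.card < 2 * W.card) : ∃ v ∈ W, F.card ≤ (edgesAvoiding F v).card + 3 := by
  classical
  by_contra! h
  have h1 : ∑ v ∈ W, (F.filter fun e => v ∈ e).card = ∑ e ∈ F, (W.filter fun v => v ∈ e).card := by
    simp only [Finset.card_filter]
    exact Finset.sum_comm
  have h2 : ∀ e ∈ F, (W.filter fun v => v ∈ e).card = 2 := fun e he => by
    obtain ⟨u, w, huw, rfl⟩ := exists_ne_of_not_isDiag (hnd e he)
    rw [← Finset.card_pair huw]
    congr 1
    ext x
    simp only [Finset.mem_filter, Sym2.mem_iff, Finset.mem_insert, Finset.mem_singleton]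
    refine ⟨fun h => h.2, fun h => ⟨hW _ he x (Sym2.mem_iff.2 h), h⟩⟩
  have h3 : ∀ v ∈ W, 4 ≤ (F.filter fun e => v ∈ e).card := fun v hv => by
    have h4 := h v hv
    have h5 := Finset.card_filter_add_card_filter_not (s := F) (fun e => v ∈ e)
    have h6 : edgesAvoiding F v = F.filter fun e => v ∉ e := by ext; simp [mem_edgesAvoiding]
    rw [h6] at h4
    omega
  have h4 := Finset.sum_le_sum h3
  rw [h1, Finset.sum_congr rfl h2] at h4
  simp only [Finset.sum_const, smul_eq_mul] at h4
  omega

theorem cases_of_card_le_three [DecidableEq V] (hnd : ∀ e ∈ F, ¬ e.IsDiag)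
    (hcard : F.card ≤ (edgesAvoiding F v).card + 3) :
    F = edgesAvoiding F v ∨
    (∃ a, a ≠ v ∧ F = insert s(v, a) (edgesAvoiding F v)) ∨
    (∃ a b, a ≠ v ∧ b ≠ v ∧ a ≠ b ∧ F = insert s(v, b) (insert s(v, a) (edgesAvoiding F v))) ∨
    ∃ a b c, a ≠ v ∧ b ≠ v ∧ c ≠ v ∧ a ≠ b ∧ b ≠ c ∧ a ≠ c ∧
      F = insert s(v, c) (insert s(v, b) (insert s(v, a) (edgesAvoiding F v))) := by
  have hS : ∀ e ∈ F.filter (fun e => v ∈ e), ∃ a, a ≠ v ∧ e = s(v, a) := fun e he => by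
    rw [Finset.mem_filter] at he
    obtain ⟨a, rfl⟩ := Sym2.mem_iff_exists.1 he.2
    exact ⟨a, fun h => hnd _ he.1 (Sym2.mk_isDiag_iff.2 h.symm), rfl⟩
  have hF : F = F.filter (fun e => v ∈ e) ∪ edgesAvoiding F v := by
    ext e
    simp only [Finset.mem_union, Finset.mem_filter, mem_edgesAvoiding]
    tauto
  have h5 := Finset.card_filter_add_card_filter_not (s := F) (fun e => v ∈ e)
  have h6 : edgesAvoiding F v = F.filter fun e => v ∉ e := by ext; simp [mem_edgesAvoiding]
  rw [← h6] at h5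
  set S := F.filter (fun e => v ∈ e)
  have h7 : S.card = 0 ∨ S.card = 1 ∨ S.card = 2 ∨ S.card = 3 := by omega
  set F₀ := edgesAvoiding F v
  rcases h7 with h7 | h7 | h7 | h7
  · rw [Finset.card_eq_zero.1 h7, Finset.empty_union] at hF
    exact .inl hF
  · obtain ⟨e, h8⟩ := Finset.card_eq_one.1 h7
    rw [h8] at hF hS
    obtain ⟨a, ha, rfl⟩ := hS e (by simp)
    exact .inr (.inl ⟨a, ha, by rw [hF]; rfl⟩)
  · obtain ⟨e, f, hef, h8⟩ := Finset.card_eq_two.1 h7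
    rw [h8] at hF hS
    obtain ⟨a, ha, rfl⟩ := hS e (by simp)
    obtain ⟨b, hb, rfl⟩ := hS f (by simp)
    refine .inr (.inr (.inl ⟨a, b, ha, hb, fun h => hef (by rw [h]), ?_⟩))
    rw [hF]; ext; simp only [Finset.mem_union, Finset.mem_insert, Finset.mem_singleton]; tauto
  · obtain ⟨e, f, g, hef, heg, hfg, h8⟩ := Finset.card_eq_three.1 h7
    rw [h8] at hF hS
    obtain ⟨a, ha, rfl⟩ := hS e (by simp)
    obtain ⟨b, hb, rfl⟩ := hS f (by simp)
    obtain ⟨c, hc, rfl⟩ := hS g (by simp)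
    refine .inr (.inr (.inr ⟨a, b, c, ha, hb, hc, fun h => hef (by rw [h]),
      fun h => hfg (by rw [h]), fun h => heg (by rw [h]), ?_⟩))
    rw [hF]; ext; simp only [Finset.mem_union, Finset.mem_insert, Finset.mem_singleton]; tauto

variable [Fintype V] [Fintype C] {χ : V → Option C} {D : Finset C} {P : Framework 2 χ}

/-- A vertex of degree at most three can be added, unless its neighbours form a rigid triangle and
the radii of the spheres involved are fixed. -/
theorem Framework.IsGeneric.rk_eq_card_or [DecidableEq V] (hP : P.IsGeneric)
    (hnd : ∀ e ∈ F, ¬ e.IsDiag) (hcard : F.card ≤ (edgesAvoiding F v).card + 3)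
    (hrk : rk χ P.pos D (edgesAvoiding F v) = (edgesAvoiding F v).card) :
    rk χ P.pos D F = F.card ∨ ∃ a b c, a ≠ v ∧ b ≠ v ∧ c ≠ v ∧ a ≠ b ∧ b ≠ c ∧ a ≠ c ∧
      F = insert s(v, c) (insert s(v, b) (insert s(v, a) (edgesAvoiding F v))) ∧
      ∀ m ∈ motions χ P.pos D (edgesAvoiding F v), speed m.2 (χ v) = 0 ∧ speed m.2 (χ a) = 0 ∧
        speed m.2 (χ b) = 0 ∧ speed m.2 (χ c) = 0 ∧ strain C P.pos a b m = 0 ∧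
        strain C P.pos b c m = 0 ∧ strain C P.pos a c m = 0 := by
  have hv : ∀ e ∈ edgesAvoiding F v, v ∉ e := notMem_of_mem_edgesAvoiding
  rcases cases_of_card_le_three hnd hcard with h | ⟨a, ha, h⟩ | ⟨a, b, ha, hb, hab, h⟩ |
    ⟨a, b, c, ha, hb, hc, hab, hbc, hac, h⟩
  · exact .inl (by rw [h]; exact hrk)
  · left
    refine le_antisymm rk_le_card ?_
    have h1 := rk_insert_of_notMem (χ := χ) (D := D) ha (hP.cross_ne_zero ha.symm) hv
    rw [← h, hrk] at h1
    rw [h1]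
    conv_lhs => rw [h]
    exact Finset.card_insert_le _ _
  · left
    refine le_antisymm rk_le_card ?_
    have h1 := rk_insert_insert_of_notMem (χ := χ) (D := D) ha hb
      (hP.triple_ne_zero ha.symm hab hb.symm) hv
    rw [← h, hrk] at h1
    rw [h1]
    conv_lhs => rw [h]
    exact (Finset.card_insert_le _ _).trans (Nat.succ_le_succ (Finset.card_insert_le _ _))
  · by_cases hm : ∀ m ∈ motions χ P.pos D (edgesAvoiding F v), speed m.2 (χ v) = 0 ∧
        speed m.2 (χ a) = 0 ∧ speed m.2 (χ b) = 0 ∧ speed m.2 (χ c) = 0 ∧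
        strain C P.pos a b m = 0 ∧ strain C P.pos b c m = 0 ∧ strain C P.pos a c m = 0
    · exact .inr ⟨a, b, c, ha, hb, hc, hab, hbc, hac, h, hm⟩
    · left
      rw [not_forall] at hm
      obtain ⟨m, hm⟩ := hm
      rw [Classical.not_imp] at hm
      have h1 := hP.rk_insert_three ha hb hc hab hbc hac hv hrk hm.1 hm.2
      rw [← h] at h1
      exact le_antisymm rk_le_card (h1 ▸ hcard)

end Combinatorics

/-! ### Laman's theorem and the cover formula for fixed radii -/

section Sparsity

variable {V C : Type*} {F F' E : Finset (Sym2 V)} {U U' W : Finset V} {a b v : V}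

/-- The sparsity condition of Laman. -/
def IsSparse (F : Finset (Sym2 V)) : Prop :=
  ∀ U : Finset V, 2 ≤ U.card → (inducedEdges F U).card + 3 ≤ 2 * U.card

/-- A set of vertices that induces the number of edges of a minimally rigid graph. -/
def IsTight (F : Finset (Sym2 V)) (U : Finset V) : Prop :=
  2 ≤ U.card ∧ (inducedEdges F U).card + 3 = 2 * U.card

theorem inducedEdges_mono (hF : F ⊆ F') (hU : U ⊆ U') : inducedEdges F U ⊆ inducedEdges F' U' :=
  fun e he => by
    rw [mem_inducedEdges] at he ⊢
    exact ⟨hF he.1, fun v hv => hU (he.2 v hv)⟩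

theorem IsSparse.subset (h : IsSparse F') (hF : F ⊆ F') : IsSparse F := fun U hU =>
  (Nat.add_le_add_right (Finset.card_le_card (inducedEdges_mono hF subset_rfl)) 3).trans (h U hU)

theorem IsSparse.isTight_pair [DecidableEq V] (h : IsSparse F) (hab : a ≠ b) (he : s(a, b) ∈ F) :
    IsTight F {a, b} := by
  have h1 : ({a, b} : Finset V).card = 2 := Finset.card_pair hab
  have h2 := h {a, b} h1.ge
  have h3 : 0 < (inducedEdges F {a, b}).card :=
    Finset.card_pos.2 ⟨s(a, b), mem_inducedEdges.2 ⟨he, by simp⟩⟩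
  exact ⟨h1.ge, by omega⟩

variable [DecidableEq V]

/-- The number of induced edges is supermodular, and sparsity bounds it on the intersection, which
has at least two vertices. -/
theorem IsSparse.isTight_union (h : IsSparse F) (hU : IsTight F U) (hU' : IsTight F U')
    (h2 : 2 ≤ (U ∩ U').card) : IsTight F (U ∪ U') := by
  have h3 := Finset.card_union_add_card_inter U U'
  have h4 := Finset.card_union_add_card_inter (inducedEdges F U) (inducedEdges F U')
  have h5 : inducedEdges F U ∩ inducedEdges F U' ⊆ inducedEdges F (U ∩ U') := fun e he => by
    simp only [Finset.mem_inter, mem_inducedEdges] at he ⊢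
    exact ⟨he.1.1, fun v hv => ⟨he.1.2 v hv, he.2.2 v hv⟩⟩
  have h6 : inducedEdges F U ∪ inducedEdges F U' ⊆ inducedEdges F (U ∪ U') :=
    Finset.union_subset (inducedEdges_mono subset_rfl Finset.subset_union_left)
      (inducedEdges_mono subset_rfl Finset.subset_union_right)
  have h7 := h _ h2
  have h8 := Finset.card_le_card h5
  have h9 := Finset.card_le_card h6
  have h10 : 2 ≤ (U ∪ U').card := hU.1.trans (Finset.card_le_card Finset.subset_union_left)
  have h11 := h _ h10
  have := hU.2
  have := hU'.2
  exact ⟨h10, by omega⟩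

/-- Every vertex of a tight set has an incident edge in that set. -/
theorem IsSparse.exists_mem_of_isTight (h : IsSparse F) (hnd : ∀ e ∈ F, ¬ e.IsDiag)
    (hU : IsTight F U) (hv : v ∈ U) : ∃ e ∈ F, v ∈ e := by
  by_contra! hcon
  have h1 : inducedEdges F U ⊆ inducedEdges F (U.erase v) := fun e he => by
    rw [mem_inducedEdges] at he ⊢
    exact ⟨he.1, fun w hw => Finset.mem_erase.2 ⟨fun h => hcon e he.1 (h ▸ hw), he.2 w hw⟩⟩
  have h2 := Finset.card_le_card h1
  have h3 := Finset.card_erase_add_one hv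
  obtain ⟨h4, h5⟩ := hU
  by_cases h6 : 2 ≤ (U.erase v).card
  · have := h _ h6
    omega
  · have h7 : 0 < (inducedEdges F (U.erase v)).card := by omega
    obtain ⟨e, he⟩ := Finset.card_pos.1 h7
    rw [mem_inducedEdges] at he
    exact h6 (two_le_card_of_forall_mem (hnd e he.1) he.2)

/-- If an edge cannot be added to a sparse set, its ends lie in a tight set. -/
theorem IsSparse.exists_isTight (h : IsSparse F) (h' : ¬ IsSparse (insert s(a, b) F)) :
    ∃ U, IsTight F U ∧ a ∈ U ∧ b ∈ U := by
  rw [IsSparse] at h'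
  push Not at h'
  obtain ⟨U, hU, hlt⟩ := h'
  have h1 := h U hU
  have hmem : ∀ e, e ∈ inducedEdges (insert s(a, b) F) U →
      e ∈ insert s(a, b) (inducedEdges F U) := fun e he => by
    rw [Finset.mem_insert]
    rw [mem_inducedEdges, Finset.mem_insert] at he
    exact he.1.imp id fun h => mem_inducedEdges.2 ⟨h, he.2⟩
  have h2 := (Finset.card_le_card hmem).trans (Finset.card_insert_le _ _)
  have h3 : s(a, b) ∈ inducedEdges (insert s(a, b) F) U := by
    by_contra h3
    have h4 : inducedEdges (insert s(a, b) F) U ⊆ inducedEdges F U := fun e he =>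
      (Finset.mem_insert.1 (hmem e he)).resolve_left fun h => h3 (h ▸ he)
    have := Finset.card_le_card h4
    omega
  have h4 := (mem_inducedEdges.1 h3).2
  exact ⟨U, ⟨hU, by omega⟩, h4 a (by simp), h4 b (by simp)⟩

theorem disjoint_inducedEdges (hnd : ∀ e ∈ F, ¬ e.IsDiag) (h : (U ∩ U').card ≤ 1) :
    Disjoint (inducedEdges F U) (inducedEdges F U') := by
  rw [Finset.disjoint_left]
  intro e h1 h2
  rw [mem_inducedEdges] at h1 h2
  have := two_le_card_of_forall_mem (hnd e h1.1)
    (fun v hv => Finset.mem_inter.2 ⟨h1.2 v hv, h2.2 v hv⟩)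
  omega

/-- Three tight sets that contain the sides of a triangle can be replaced by one tight set. -/
theorem IsSparse.exists_isTight_triangle (h : IsSparse F) (hnd : ∀ e ∈ F, ¬ e.IsDiag) {a b c : V}
    (hac : a ≠ c) {U₁ U₂ U₃ : Finset V} (h1 : IsTight F U₁) (h2 : IsTight F U₂)
    (h3 : IsTight F U₃) (ha1 : a ∈ U₁) (hb1 : b ∈ U₁) (hb2 : b ∈ U₂) (hc2 : c ∈ U₂)
    (ha3 : a ∈ U₃) (hc3 : c ∈ U₃) : ∃ U, IsTight F U ∧ a ∈ U ∧ b ∈ U ∧ c ∈ U := by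
  by_cases h12 : 2 ≤ (U₁ ∩ U₂).card
  · exact ⟨_, h.isTight_union h1 h2 h12, by simp [*]⟩
  by_cases h13 : 2 ≤ (U₁ ∩ U₃).card
  · exact ⟨_, h.isTight_union h1 h3 h13, by simp [*]⟩
  by_cases h23 : 2 ≤ (U₂ ∩ U₃).card
  · exact ⟨_, h.isTight_union h2 h3 h23, by simp [*]⟩
  refine ⟨U₁ ∪ U₂ ∪ U₃, ?_, by simp [*]⟩
  have d12 := disjoint_inducedEdges hnd (show (U₁ ∩ U₂).card ≤ 1 by omega)
  have d13 := disjoint_inducedEdges hnd (show (U₁ ∩ U₃).card ≤ 1 by omega)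
  have d23 := disjoint_inducedEdges hnd (show (U₂ ∩ U₃).card ≤ 1 by omega)
  have h4 : inducedEdges F U₁ ∪ inducedEdges F U₂ ∪ inducedEdges F U₃ ⊆
      inducedEdges F (U₁ ∪ U₂ ∪ U₃) := by
    refine Finset.union_subset (Finset.union_subset ?_ ?_) ?_ <;>
      refine inducedEdges_mono subset_rfl fun x hx => ?_ <;> simp [hx]
  have h5 := Finset.card_le_card h4
  rw [Finset.card_union_of_disjoint (Finset.disjoint_union_left.2 ⟨d13, d23⟩),
    Finset.card_union_of_disjoint d12] at h5
  -- The overlaps contain b, and then a and c. With s the sum of the three sizes, the union has at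
  -- most s - 3 vertices and at least 2s - 9 = 2(s - 3) - 3 edges.
  have h6 := Finset.card_union_add_card_inter U₁ U₂
  have h7 := Finset.card_union_add_card_inter (U₁ ∪ U₂) U₃
  have h8 : 0 < (U₁ ∩ U₂).card := Finset.card_pos.2 ⟨b, by simp [*]⟩
  have h9 : 2 ≤ ((U₁ ∪ U₂) ∩ U₃).card := by
    rw [← Finset.card_pair hac]
    exact Finset.card_le_card (by simp [Finset.insert_subset_iff, *])
  have h10 : 2 ≤ (U₁ ∪ U₂ ∪ U₃).card := h1.1.trans
    (Finset.card_le_card (Finset.subset_union_left.trans Finset.subset_union_left))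
  have h11 := h _ h10
  have := h1.2
  have := h2.2
  have := h3.2
  exact ⟨h10, by omega⟩

theorem mem_erase_of_mem_edgesAvoiding (hW : ∀ e ∈ F, ∀ v ∈ e, v ∈ W) :
    ∀ e ∈ edgesAvoiding F v, ∀ w ∈ e, w ∈ W.erase v := fun e he w hw => by
  rw [mem_edgesAvoiding] at he
  exact Finset.mem_erase.2 ⟨fun h => he.2 (h ▸ hw), hW e he.1 w hw⟩

variable [Fintype V] [Fintype C] {χ : V → Option C} {P : Framework 2 χ}

/-- Laman's theorem on the sphere. -/
theorem Framework.IsGeneric.rk_empty_of_isSparse (hP : P.IsGeneric) :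
    ∀ (W : Finset V) (F : Finset (Sym2 V)), (∀ e ∈ F, ¬ e.IsDiag) → (∀ e ∈ F, ∀ v ∈ e, v ∈ W) →
      IsSparse F → rk χ P.pos ∅ F = F.card := by
  intro W
  induction W using Finset.strongInduction with | H W ih => ?_
  intro F hnd hW hsp
  rcases F.eq_empty_or_nonempty with rfl | ⟨e, he⟩
  · rw [rk_empty, Finset.card_empty]
  have h2 := two_le_card_of_forall_mem (hnd e he) (hW e he)
  have h3 := hsp W h2
  rw [inducedEdges_eq_self hW] at h3
  obtain ⟨v, hv, hdeg⟩ := exists_card_incident_le_three hnd hW (by omega)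
  have hsub : edgesAvoiding F v ⊆ F := edgesAvoiding_subset
  have hsp₀ := hsp.subset hsub
  have hnd₀ : ∀ e ∈ edgesAvoiding F v, ¬ e.IsDiag := fun e he => hnd e (hsub he)
  have hW₀ := mem_erase_of_mem_edgesAvoiding (v := v) hW
  have hv₀ : ∀ e ∈ edgesAvoiding F v, v ∉ e := notMem_of_mem_edgesAvoiding
  have ih := ih _ (Finset.erase_ssubset hv)
  have hrk := ih _ hnd₀ hW₀ hsp₀
  rcases hP.rk_eq_card_or hnd hdeg hrk with h | ⟨a, b, c, ha, hb, hc, hab, hbc, hac, hF, hm⟩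
  · exact h
  exfalso
  have hmem : ∀ w, s(v, w) ∈ F → w ≠ v → w ∈ W.erase v := fun w hw hne =>
    Finset.mem_erase.2 ⟨hne, hW _ hw w (Sym2.mem_mk_right v w)⟩
  have haW := hmem a (by rw [hF]; simp) ha
  have hbW := hmem b (by rw [hF]; simp) hb
  have hcW := hmem c (by rw [hF]; simp) hc
  -- If xy could be added to the sparse set, the result would be independent by induction; but xy
  -- imposes no new condition on the motions.
  have key : ∀ x y, x ≠ y → x ∈ W.erase v → y ∈ W.erase v →
      (∀ m ∈ motions χ P.pos ∅ (edgesAvoiding F v), strain C P.pos x y m = 0) →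
      ∃ U, IsTight (edgesAvoiding F v) U ∧ x ∈ U ∧ y ∈ U := by
    intro x y hxy hx hy hs
    by_cases hmem : s(x, y) ∈ edgesAvoiding F v
    · exact ⟨_, hsp₀.isTight_pair hxy hmem, by simp⟩
    · refine hsp₀.exists_isTight fun hsp' => ?_
      have h1 := ih _ (by
          intro e he
          rcases Finset.mem_insert.1 he with rfl | he
          · rwa [Sym2.mk_isDiag_iff]
          · exact hnd₀ e he) (by
          intro e he
          rcases Finset.mem_insert.1 he with rfl | he
          · simp only [Sym2.mem_iff, forall_eq_or_imp, forall_eq]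
            exact ⟨hx, hy⟩
          · exact hW₀ e he) hsp'
      rw [Finset.card_insert_of_notMem hmem, rk, motions_insert_eq_self hs, ← rk, hrk] at h1
      omega
  obtain ⟨U₁, h1, ha1, hb1⟩ := key a b hab haW hbW fun m hm' => (hm m hm').2.2.2.2.1
  obtain ⟨U₂, h2, hb2, hc2⟩ := key b c hbc hbW hcW fun m hm' => (hm m hm').2.2.2.2.2.1
  obtain ⟨U₃, h3, ha3, hc3⟩ := key a c hac haW hcW fun m hm' => (hm m hm').2.2.2.2.2.2
  obtain ⟨U, hU, haU, hbU, hcU⟩ :=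
    hsp₀.exists_isTight_triangle hnd₀ hac h1 h2 h3 ha1 hb1 hb2 hc2 ha3 hc3
  have hvU : v ∉ U := fun hv => by
    obtain ⟨e, he, hve⟩ := hsp₀.exists_mem_of_isTight hnd₀ hU hv
    exact hv₀ e he hve
  -- Adding v to U gives 2|U| edges on |U| + 1 vertices, one more than sparsity allows.
  have h4 : insert s(v, c) (insert s(v, b) (insert s(v, a) (inducedEdges (edgesAvoiding F v) U))) ⊆
      inducedEdges F (insert v U) := by
    have h5 := inducedEdges_mono hsub (Finset.subset_insert v U)
    refine Finset.insert_subset ?_ (Finset.insert_subset ?_ (Finset.insert_subset ?_ h5)) <;>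
      refine mem_inducedEdges.2 ⟨by rw [hF]; simp, by simp [*]⟩
  have h5 := Finset.card_le_card h4
  have hFv : ∀ w, s(v, w) ∉ inducedEdges (edgesAvoiding F v) U := fun w hw =>
    hv₀ _ (mem_inducedEdges.1 hw).1 (Sym2.mem_mk_left v w)
  rw [Finset.card_insert_of_notMem, Finset.card_insert_of_notMem,
    Finset.card_insert_of_notMem (hFv a)] at h5
  · have h6 := Finset.card_insert_of_notMem hvU
    have h7 := hsp (insert v U) (by have := hU.1; omega)
    have := hU.2
    omega
  · simp [hFv, hab.symm, hb]
  · simp [hFv, hbc.symm, hac.symm, hc]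

/-- The rank formula of Lovász and Yemini on the sphere: the rank is attained by a cover. -/
theorem Framework.IsGeneric.exists_cover (hP : P.IsGeneric) (hnd : ∀ e ∈ E, ¬ e.IsDiag) :
    ∃ 𝒳 : Finset (Finset V), (∀ Y ∈ 𝒳, 2 ≤ Y.card ∧ ∀ v ∈ Y, ∃ e ∈ E, v ∈ e) ∧ IsOneThin 𝒳 ∧
      (∀ e ∈ E, ∃ Y ∈ 𝒳, ∀ v ∈ e, v ∈ Y) ∧
      ∑ Y ∈ 𝒳, (2 * (Y.card : ℤ) - 3) ≤ rk χ P.pos ∅ E := by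
  classical
  let I := E.powerset.filter IsSparse
  have hI : ∀ F, F ∈ I ↔ F ⊆ E ∧ IsSparse F := fun F => by simp [I, Finset.mem_powerset]
  obtain ⟨F, hF, hFmax⟩ := I.exists_max_image Finset.card ⟨∅, (hI _).2 ⟨Finset.empty_subset _,
    fun U hU => by simp [inducedEdges]; omega⟩⟩
  obtain ⟨hFE, hsp⟩ := (hI F).1 hF
  have hndF : ∀ e ∈ F, ¬ e.IsDiag := fun e he => hnd e (hFE he)
  -- The cover consists of the maximal tight sets of a maximum sparse F. Tight sets sharing two
  -- vertices merge, and every edge of E has its ends in a tight set.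
  let 𝒳 : Finset (Finset V) := Finset.univ.filter fun U => Maximal (IsTight F) U
  have h𝒳 : ∀ U, U ∈ 𝒳 ↔ Maximal (IsTight F) U := fun U => by simp [𝒳]
  have hthin : IsOneThin 𝒳 := by
    intro Y hY Z hZ hne
    rw [h𝒳] at hY hZ
    by_contra! h
    have h1 := hsp.isTight_union hY.1 hZ.1 h
    exact hne ((hY.eq_of_le h1 Finset.subset_union_left).trans
      (hZ.eq_of_le h1 Finset.subset_union_right).symm)
  refine ⟨𝒳, fun Y hY => ?_, hthin, fun e he => ?_, ?_⟩
  · rw [h𝒳] at hY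
    refine ⟨hY.1.1, fun v hv => ?_⟩
    obtain ⟨e, he, hve⟩ := hsp.exists_mem_of_isTight hndF hY.1 hv
    exact ⟨e, hFE he, hve⟩
  · obtain ⟨u, w, huw, rfl⟩ := exists_ne_of_not_isDiag (hnd e he)
    have h1 : ∃ U, IsTight F U ∧ u ∈ U ∧ w ∈ U := by
      by_cases h : s(u, w) ∈ F
      · exact ⟨_, hsp.isTight_pair huw h, by simp⟩
      · refine hsp.exists_isTight fun h' => ?_
        have := hFmax _ ((hI _).2 ⟨Finset.insert_subset he hFE, h'⟩)
        rw [Finset.card_insert_of_notMem h] at this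
        omega
    obtain ⟨U, hU, hu, hw⟩ := h1
    obtain ⟨Y, hUY, hY⟩ := (Set.toFinite {U | IsTight F U}).exists_le_maximal hU
    refine ⟨Y, (h𝒳 Y).2 hY, ?_⟩
    simp only [Sym2.mem_iff, forall_eq_or_imp, forall_eq]
    exact ⟨hUY hu, hUY hw⟩
  · have h1 : ∑ Y ∈ 𝒳, (inducedEdges F Y).card ≤ F.card := by
      rw [← Finset.card_biUnion fun Y hY Z hZ hne =>
        disjoint_inducedEdges hndF (hthin Y hY Z hZ hne)]
      refine Finset.card_le_card (Finset.biUnion_subset.2 fun Y _ e he => ?_)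
      exact (mem_inducedEdges.1 he).1
    have h2 := hP.rk_empty_of_isSparse Finset.univ F hndF (fun _ _ v _ => Finset.mem_univ v) hsp
    have h3 : rk χ P.pos ∅ F ≤ rk χ P.pos ∅ E := rk_mono hFE
    have h4 : ∑ Y ∈ 𝒳, (2 * (Y.card : ℤ) - 3) = ∑ Y ∈ 𝒳, ((inducedEdges F Y).card : ℤ) := by
      refine Finset.sum_congr rfl fun Y hY => ?_
      have := ((h𝒳 Y).1 hY).1.2
      omega
    rw [h4, ← Nat.cast_sum]
    exact_mod_cast h1.trans (h2 ▸ h3)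

end Sparsity

/-! ### Independence when at most two radii vary -/

section Independence

variable {V C : Type*} {χ : V → Option C} {D D' : Finset C} {S T F E : Finset (Sym2 V)}

theorem coloursAt_mono (hD : D ⊆ D') (h : S ⊆ T) : coloursAt χ D S ⊆ coloursAt χ D' T :=
  fun c hc => by
    rw [mem_coloursAt] at hc ⊢
    obtain ⟨h1, e, he, h2⟩ := hc
    exact ⟨hD h1, e, h he, h2⟩

variable [DecidableEq V]

theorem card_coloursAt_union_add_inter :
    (coloursAt χ D (S ∪ T)).card + (coloursAt χ D (S ∩ T)).card ≤
      (coloursAt χ D S).card + (coloursAt χ D T).card := by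
  classical
  rw [← Finset.card_union_add_card_inter (coloursAt χ D S)]
  refine Nat.add_le_add (Finset.card_le_card fun c hc => ?_)
    (Finset.card_le_card (Finset.subset_inter (coloursAt_mono subset_rfl Finset.inter_subset_left)
      (coloursAt_mono subset_rfl Finset.inter_subset_right)))
  rw [Finset.mem_union]
  obtain ⟨h1, e, he, h2⟩ := mem_coloursAt.1 hc
  rcases Finset.mem_union.1 he with he | he
  · exact .inl (mem_coloursAt.2 ⟨h1, e, he, h2⟩)
  · exact .inr (mem_coloursAt.2 ⟨h1, e, he, h2⟩)

variable [Fintype V] [Fintype C]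

/-- A rank formula for all sets of edges follows from one for independent sets. -/
theorem exists_card_sdiff_add_le {p : V → Fin 3 → ℝ}
    (h : ∀ F ⊆ E, (∀ T ⊆ F, T.card ≤ rk χ p ∅ T + (coloursAt χ D T).card) →
      rk χ p D F = F.card) :
    ∃ T ⊆ E, (E \ T).card + (rk χ p ∅ T + (coloursAt χ D T).card) ≤ rk χ p D E := by
  obtain ⟨F, hF, hind, T, hT, hle⟩ := exists_indep_card_ge
    (f := fun T => rk χ p ∅ T + (coloursAt χ D T).card)
    (fun h => Nat.add_le_add (rk_mono h) (Finset.card_le_card (coloursAt_mono subset_rfl h)))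
    (fun S T => by
      have h1 := rk_union_add_rk_inter (χ := χ) (p := p) (D := ∅) S T
      have h2 := card_coloursAt_union_add_inter (χ := χ) (D := D) (S := S) (T := T)
      omega)
    (by simp [rk_empty, coloursAt]) E
  refine ⟨T, hT, hle.trans ?_⟩
  rw [← h F hF hind]
  exact rk_mono hF

variable {P : Framework 2 χ} {v a b c : V}

/-- The edges of a triangle. -/
def triangle (a b c : V) : Finset (Sym2 V) := {s(a, b), s(a, c), s(b, c)}

omit [Fintype V] [Fintype C] in
theorem mem_triangle {e : Sym2 V} :
    e ∈ triangle a b c ↔ e = s(a, b) ∨ e = s(a, c) ∨ e = s(b, c) := by simp [triangle]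

omit [Fintype V] [Fintype C] in
theorem mem_of_mem_triangle {e : Sym2 V} (he : e ∈ triangle a b c) {w : V} (hw : w ∈ e) :
    w = a ∨ w = b ∨ w = c := by
  rcases mem_triangle.1 he with rfl | rfl | rfl <;> rcases Sym2.mem_iff.1 hw with rfl | rfl <;>
    simp

theorem Framework.IsGeneric.three_le_rk_triangle (hP : P.IsGeneric) (hab : a ≠ b) (hbc : b ≠ c)
    (hac : a ≠ c) : 3 ≤ rk χ P.pos D (triangle a b c) := by
  have h1 : rk χ P.pos D {s(b, c)} = 1 := by
    have := rk_insert_of_notMem (χ := χ) (D := D) (F := ∅) hbc.symm (hP.cross_ne_zero hbc)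
      (by simp)
    rwa [rk_empty] at this
  have h2 := rk_insert_insert_of_notMem (χ := χ) (D := D) (F := {s(b, c)}) hac.symm hab.symm
    (hP.triple_ne_zero hac hbc.symm hab) (by simp [hab, hac])
  rw [triangle, h2, h1]

/-- Joining a vertex to a triangle raises the rank by at most two if the radii are fixed. -/
theorem Framework.IsGeneric.rk_empty_insert_three_le (hP : P.IsGeneric) (hab : a ≠ b)
    (hbc : b ≠ c) (hac : a ≠ c) (hT : triangle a b c ⊆ T) :
    rk χ P.pos ∅ (insert s(v, c) (insert s(v, b) (insert s(v, a) T))) ≤ rk χ P.pos ∅ T + 2 := by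
  -- K lies on at most four vertices, so its rank is at most 5, while the triangle already has rank
  -- 3; submodularity leaves 2.
  let K := insert s(v, c) (insert s(v, b) (insert s(v, a) (triangle a b c)))
  have h1 := rk_union_add_rk_inter (χ := χ) (p := P.pos) (D := ∅) T K
  have h2 : rk χ P.pos ∅ (triangle a b c) ≤ rk χ P.pos ∅ (T ∩ K) :=
    rk_mono (Finset.subset_inter hT ((Finset.subset_insert _ _).trans
      ((Finset.subset_insert _ _).trans (Finset.subset_insert _ _))))
  have h3 := hP.three_le_rk_triangle (D := ∅) hab hbc hac
  have h4 : rk χ P.pos ∅ K + 3 ≤ 2 * ({v, a, b, c} : Finset V).card := by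
    refine rk_empty_add_three_le P.pos_ne_zero (a := a) (b := b) (by simp) (by simp)
      (hP.cross_ne_zero hab) fun e he w hw => ?_
    simp only [K, Finset.mem_insert] at he ⊢
    rcases he with rfl | rfl | rfl | he
    · rcases Sym2.mem_iff.1 hw with rfl | rfl <;> simp
    · rcases Sym2.mem_iff.1 hw with rfl | rfl <;> simp
    · rcases Sym2.mem_iff.1 hw with rfl | rfl <;> simp
    · rcases mem_of_mem_triangle he hw with rfl | rfl | rfl <;> simp
  have h5 : ({v, a, b, c} : Finset V).card ≤ 4 := Finset.card_le_four
  have h6 : rk χ P.pos ∅ (insert s(v, c) (insert s(v, b) (insert s(v, a) T))) ≤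
      rk χ P.pos ∅ (T ∪ K) := rk_mono (by
    intro e; simp only [K, Finset.mem_insert, Finset.mem_union]; tauto)
  omega

/-- The combinatorial characterisation of independence when at most two radii vary. -/
theorem Framework.IsGeneric.rk_eq_card_of_forall_le (hP : P.IsGeneric)
    (hk : ∀ F, (coloursAt χ Finset.univ F).card ≤ 2) :
    ∀ (W : Finset V) (D : Finset C) (F : Finset (Sym2 V)), (∀ e ∈ F, ¬ e.IsDiag) →
      (∀ e ∈ F, ∀ v ∈ e, v ∈ W) →
      (∀ T ⊆ F, T.card ≤ rk χ P.pos ∅ T + (coloursAt χ D T).card) → rk χ P.pos D F = F.card := by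
  classical
  intro W
  induction W using Finset.strongInduction with | H W ih => ?_
  intro D F hnd hW hind
  rcases F.eq_empty_or_nonempty with rfl | ⟨e, he⟩
  · rw [rk_empty, Finset.card_empty]
  -- Here k ≤ 2 matters: |F| ≤ (2|W| - 3) + 2.
  have hlt : F.card < 2 * W.card := by
    obtain ⟨x, y, hxy, rfl⟩ := exists_ne_of_not_isDiag (hnd e he)
    have h1 := rk_empty_add_three_le (χ := χ) P.pos_ne_zero (hW _ he x (by simp))
      (hW _ he y (by simp)) (hP.cross_ne_zero hxy) hW
    have h2 := hind F subset_rfl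
    have h3 := (Finset.card_le_card (coloursAt_mono (χ := χ) (Finset.subset_univ D)
      (subset_refl F))).trans (hk F)
    omega
  obtain ⟨v, hv, hdeg⟩ := exists_card_incident_le_three hnd hW hlt
  have hsub : edgesAvoiding F v ⊆ F := edgesAvoiding_subset
  have hnd₀ : ∀ e ∈ edgesAvoiding F v, ¬ e.IsDiag := fun e he => hnd e (hsub he)
  have hW₀ := mem_erase_of_mem_edgesAvoiding (v := v) hW
  have hv₀ : ∀ e ∈ edgesAvoiding F v, v ∉ e := notMem_of_mem_edgesAvoiding
  have ih := ih _ (Finset.erase_ssubset hv)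
  have hrk := ih D _ hnd₀ hW₀ fun T hT => hind T (hT.trans hsub)
  rcases hP.rk_eq_card_or hnd hdeg hrk with h | ⟨a, b, c, ha, hb, hc, hab, hbc, hac, hF, hm⟩
  · exact h
  exfalso
  set F₀ := edgesAvoiding F v
  have hmem : ∀ w, s(v, w) ∈ F → w ≠ v → w ∈ W.erase v := fun w hw hne =>
    Finset.mem_erase.2 ⟨hne, hW _ hw w (Sym2.mem_mk_right v w)⟩
  have haW := hmem a (by rw [hF]; simp) ha
  have hbW := hmem b (by rw [hF]; simp) hb
  have hcW := hmem c (by rw [hF]; simp) hc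
  let H := F₀ ∪ triangle a b c
  -- The colours of v, a, b, c: every motion of F₀ fixes their radii and preserves the triangle, so
  -- freezing them and adding the triangle loses no motion.
  let D₄ := D.filter fun d => χ v = some d ∨ χ a = some d ∨ χ b = some d ∨ χ c = some d
  have hH : motions χ P.pos (D \ D₄) H = motions χ P.pos D F₀ := by
    refine le_antisymm ((motions_anti Finset.subset_union_left).trans
      (motions_mono Finset.sdiff_subset)) fun m hm' => ?_
    obtain ⟨hsv, hsa, hsb, hsc, hsab, hsbc, hsac⟩ := hm m hm'
    refine ⟨fun u w huw => ?_, hm'.2.1, fun d hd => ?_⟩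
    · rcases Finset.mem_union.1 huw with h | h
      · exact hm'.1 u w h
      · rcases mem_triangle.1 h with h | h | h <;>
          rcases Sym2.eq_iff.1 h with ⟨rfl, rfl⟩ | ⟨rfl, rfl⟩ <;>
          first | assumption | (rw [strain_comm]; assumption)
    · by_cases hdD : d ∈ D
      · rw [Finset.mem_sdiff, not_and_not_right] at hd
        rcases (Finset.mem_filter.1 (hd hdD)).2 with h | h | h | h
        · rwa [h] at hsv
        · rwa [h] at hsa
        · rwa [h] at hsb
        · rwa [h] at hsc
      · exact hm'.2.2 d hdD
  have hrkH : rk χ P.pos (D \ D₄) H + D₄.card = F₀.card := by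
    have h1 := rk_add_finrank (χ := χ) (p := P.pos) (D := D) (F := F₀)
    have h2 := rk_add_finrank (χ := χ) (p := P.pos) (D := D \ D₄) (F := H)
    rw [finrank_motions_empty P.pos_ne_zero] at h1 h2
    rw [hH] at h2
    have h3 := Finset.card_sdiff_add_card_eq_card
      (show D₄ ⊆ D from Finset.filter_subset _ D)
    omega
  have hndH : ∀ e ∈ H, ¬ e.IsDiag := fun e he => by
    rcases Finset.mem_union.1 he with he | he
    · exact hnd₀ e he
    · rcases mem_triangle.1 he with rfl | rfl | rfl <;> rwa [Sym2.mk_isDiag_iff]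
  have hWH : ∀ e ∈ H, ∀ w ∈ e, w ∈ W.erase v := fun e he w hw => by
    rcases Finset.mem_union.1 he with he | he
    · exact hW₀ e he w hw
    · rcases mem_of_mem_triangle he hw with rfl | rfl | rfl <;> assumption
  obtain ⟨T, hT, hle⟩ := exists_card_sdiff_add_le (χ := χ) (D := D \ D₄) (E := H) (p := P.pos)
    fun S hS hind => ih _ S (fun e he => hndH e (hS he)) (fun e he => hWH e (hS he)) hind
  -- The triangle can be put into the minimising set for free: each new edge costs at most one in
  -- rank and saves one outside, and its colours are frozen.
  let T' := T ∪ triangle a b c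
  have hcol : coloursAt χ (D \ D₄) T' ⊆ coloursAt χ (D \ D₄) T := fun d hd => by
    obtain ⟨hdD, e, he, w, hwe, hw⟩ := mem_coloursAt.1 hd
    rcases Finset.mem_union.1 he with he | he
    · exact mem_coloursAt.2 ⟨hdD, e, he, w, hwe, hw⟩
    · obtain ⟨h1, h2⟩ := Finset.mem_sdiff.1 hdD
      refine (h2 (Finset.mem_filter.2 ⟨h1, ?_⟩)).elim
      rcases mem_of_mem_triangle he hwe with rfl | rfl | rfl <;> simp [hw]
  have hT' : (H \ T').card + (rk χ P.pos ∅ T' + (coloursAt χ (D \ D₄) T').card) ≤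
      rk χ P.pos (D \ D₄) H := by
    have h1 := rk_union_le_add_card (χ := χ) (p := P.pos) (D := ∅) T (triangle a b c \ T)
    rw [Finset.union_sdiff_self_eq_union] at h1
    have h2 : (H \ T').card + (triangle a b c \ T).card ≤ (H \ T).card := by
      rw [← Finset.card_union_of_disjoint]
      · refine Finset.card_le_card fun e => ?_
        simp only [H, T', Finset.mem_union, Finset.mem_sdiff]; tauto
      · rw [Finset.disjoint_left]
        intro e
        simp only [T', Finset.mem_union, Finset.mem_sdiff]; tauto
    have h3 := Finset.card_le_card hcol
    have h4 : rk χ P.pos ∅ T' ≤ rk χ P.pos ∅ T + (triangle a b c \ T).card := h1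
    omega
  let S := insert s(v, c) (insert s(v, b) (insert s(v, a) T'))
  have hrkS : rk χ P.pos ∅ S ≤ rk χ P.pos ∅ T' + 2 :=
    hP.rk_empty_insert_three_le hab hbc hac Finset.subset_union_right
  have hcolS : coloursAt χ D S ⊆ coloursAt χ (D \ D₄) T' ∪ D₄ := fun d hd => by
    obtain ⟨hdD, e, he, w, hwe, hw⟩ := mem_coloursAt.1 hd
    rw [Finset.mem_union]
    by_cases hd₄ : d ∈ D₄
    · exact .inr hd₄
    left
    refine mem_coloursAt.2 ⟨Finset.mem_sdiff.2 ⟨hdD, hd₄⟩, ?_⟩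
    simp only [D₄, Finset.mem_filter, hdD, true_and, not_or] at hd₄
    obtain ⟨g1, g2, g3, g4⟩ := hd₄
    simp only [S, Finset.mem_insert] at he
    rcases he with rfl | rfl | rfl | he
    · rcases Sym2.mem_iff.1 hwe with rfl | rfl <;> contradiction
    · rcases Sym2.mem_iff.1 hwe with rfl | rfl <;> contradiction
    · rcases Sym2.mem_iff.1 hwe with rfl | rfl <;> contradiction
    · exact ⟨e, he, w, hwe, hw⟩
  have h1 := hind (F ∩ S) Finset.inter_subset_left
  have h2 : rk χ P.pos ∅ (F ∩ S) ≤ rk χ P.pos ∅ S := rk_mono Finset.inter_subset_right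
  have h3 := Finset.card_le_card (coloursAt_mono (χ := χ) (subset_refl D)
    (Finset.inter_subset_right : F ∩ S ⊆ S))
  have h4 := (Finset.card_le_card hcolS).trans (Finset.card_union_le _ _)
  have h5 : F \ S ⊆ H \ T' := fun e he => by
    rw [Finset.mem_sdiff, hF] at he
    simp only [S, Finset.mem_insert, not_or] at he
    rw [Finset.mem_sdiff]
    refine ⟨Finset.mem_union_left _ ?_, he.2.2.2.2⟩
    tauto
  have h6 := Finset.card_le_card h5
  have h7 := Finset.card_sdiff_add_card_inter F S
  have h8 : F.card = F₀.card + 3 := by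
    have hFv : ∀ w, s(v, w) ∉ F₀ := fun w hw => hv₀ _ hw (Sym2.mem_mk_left v w)
    rw [hF, Finset.card_insert_of_notMem, Finset.card_insert_of_notMem,
      Finset.card_insert_of_notMem (hFv a)]
    · simp [hFv, hab.symm, hb]
    · simp [hFv, hbc.symm, hac.symm, hc]
  -- Altogether |F| ≤ |H \ T'| + rk_∅(T') + 2 + |colours at T'| + |D₄| ≤ |F₀| + 2 = |F| - 1.
  omega

end Independence

/-! ### The two inequalities between the rank and the values of covers -/

section Covers

variable {V C : Type*} [DecidableEq V] [DecidableEq C] [Fintype V] [Fintype C]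
  {χ : V → Option C} {P : Framework 2 χ} {E : Finset (Sym2 V)} {X : Finset V}
  {𝒳 : Finset (Finset V)}

omit [DecidableEq V] [Fintype V] in
theorem card_coloursAt_le_numColours (h : ∀ e ∈ E, ∀ v ∈ e, v ∈ X) :
    (coloursAt χ Finset.univ E).card ≤ numColours χ X := by
  refine Finset.card_le_card fun c hc => ?_
  obtain ⟨-, e, he, v, hv, hc⟩ := mem_coloursAt.1 hc
  rw [Finset.mem_eraseNone, Finset.mem_image]
  exact ⟨v, h e he v hv, hc⟩

omit [DecidableEq V] [Fintype V] in
theorem numColours_le_card_coloursAt (h : ∀ v ∈ X, ∃ e ∈ E, v ∈ e) :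
    numColours χ X ≤ (coloursAt χ Finset.univ E).card := by
  refine Finset.card_le_card fun c hc => ?_
  rw [Finset.mem_eraseNone, Finset.mem_image] at hc
  obtain ⟨v, hv, hc⟩ := hc
  obtain ⟨e, he, hve⟩ := h v hv
  exact mem_coloursAt.2 ⟨Finset.mem_univ c, e, he, v, hve, hc⟩

omit [DecidableEq C] in
theorem rk_biUnion_le (p : V → Fin 3 → ℝ) (D : Finset C) (𝒳 : Finset (Finset V))
    (f : Finset V → Finset (Sym2 V)) :
    rk χ p D (𝒳.biUnion f) ≤ ∑ Y ∈ 𝒳, rk χ p D (f Y) := by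
  induction 𝒳 using Finset.induction_on with
  | empty => simp [rk_empty]
  | insert Y 𝒳 hY ih =>
    rw [Finset.biUnion_insert, Finset.sum_insert hY]
    have := rk_union_add_rk_inter (χ := χ) (p := p) (D := D) (f Y) (𝒳.biUnion f)
    omega

/-- The rank is at most the value of every restricted cover. -/
theorem Framework.IsGeneric.rk_le_of_cover (hP : P.IsGeneric) (hnd : ∀ e ∈ E, ¬ e.IsDiag)
    (h2 : ∀ Y ∈ 𝒳, 2 ≤ Y.card) (hcov : ∀ e ∈ E, ∃ Y ∈ 𝒳, ∀ v ∈ e, v ∈ Y)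
    (hX : IsRestricted X 𝒳) :
    (rk χ P.pos Finset.univ E : ℤ) ≤ ∑ Y ∈ 𝒳, (2 * (Y.card : ℤ) - 3) + numColours χ X := by
  -- Large members lie in X, so the colours at their edges are paid for by k(X). A two-element
  -- member holds at most one edge, which costs 1 even with all radii free.
  let 𝒴 := 𝒳.filter fun Y => 3 ≤ Y.card
  let 𝒵 := 𝒳.filter fun Y => ¬ 3 ≤ Y.card
  let E₁ := 𝒴.biUnion (inducedEdges E)
  let E₂ := 𝒵.biUnion (inducedEdges E)
  have hone : ∀ Y ∈ 𝒳, (rk χ P.pos ∅ (inducedEdges E Y) : ℤ) ≤ 2 * (Y.card : ℤ) - 3 := by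
    intro Y hY
    obtain ⟨a, ha, b, hb, hab⟩ := Finset.one_lt_card.1 (h2 Y hY)
    have := rk_empty_add_three_le (χ := χ) (F := inducedEdges E Y) P.pos_ne_zero ha hb
      (hP.cross_ne_zero hab) fun e he => (mem_inducedEdges.1 he).2
    omega
  have hE₂ : (E₂.card : ℤ) ≤ ∑ Y ∈ 𝒵, (2 * (Y.card : ℤ) - 3) := by
    have h3 : E₂.card ≤ ∑ Y ∈ 𝒵, 1 := by
      refine Finset.card_biUnion_le.trans (Finset.sum_le_sum fun Y hY => ?_)
      rw [Finset.mem_filter] at hY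
      have hY2 : Y.card = 2 := by have := h2 Y hY.1; omega
      obtain ⟨x, y, hxy, rfl⟩ := Finset.card_eq_two.1 hY2
      rw [← Finset.card_singleton s(x, y)]
      refine Finset.card_le_card fun e he => ?_
      obtain ⟨he, hmem⟩ := mem_inducedEdges.1 he
      obtain ⟨u, w, huw, rfl⟩ := exists_ne_of_not_isDiag (hnd e he)
      simp only [Sym2.mem_iff, forall_eq_or_imp, forall_eq, Finset.mem_insert,
        Finset.mem_singleton] at hmem ⊢
      rw [Sym2.eq_iff]
      rcases hmem with ⟨rfl | rfl, rfl | rfl⟩ <;> simp_all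
    have h4 : ∑ Y ∈ 𝒵, (1 : ℤ) ≤ ∑ Y ∈ 𝒵, (2 * (Y.card : ℤ) - 3) := by
      refine Finset.sum_le_sum fun Y hY => ?_
      have := h2 Y (Finset.mem_filter.1 hY).1
      omega
    refine le_trans ?_ h4
    exact_mod_cast h3
  have hE₁ : (rk χ P.pos ∅ E₁ : ℤ) ≤ ∑ Y ∈ 𝒴, (2 * (Y.card : ℤ) - 3) := by
    have h3 := rk_biUnion_le (χ := χ) P.pos ∅ 𝒴 (inducedEdges E)
    have h4 : ∑ Y ∈ 𝒴, (rk χ P.pos ∅ (inducedEdges E Y) : ℤ) ≤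
        ∑ Y ∈ 𝒴, (2 * (Y.card : ℤ) - 3) :=
      Finset.sum_le_sum fun Y hY => hone Y (Finset.mem_filter.1 hY).1
    refine le_trans ?_ h4
    exact_mod_cast h3
  have hsub : E ⊆ E₁ ∪ E₂ := fun e he => by
    obtain ⟨Y, hY, hYe⟩ := hcov e he
    rw [Finset.mem_union, Finset.mem_biUnion, Finset.mem_biUnion]
    by_cases h3 : 3 ≤ Y.card
    · exact .inl ⟨Y, Finset.mem_filter.2 ⟨hY, h3⟩, mem_inducedEdges.2 ⟨he, hYe⟩⟩
    · exact .inr ⟨Y, Finset.mem_filter.2 ⟨hY, h3⟩, mem_inducedEdges.2 ⟨he, hYe⟩⟩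
  have h5 : rk χ P.pos Finset.univ E ≤ rk χ P.pos Finset.univ E₁ + E₂.card :=
    (rk_mono hsub).trans (rk_union_le_add_card _ _)
  have h6 := rk_le_rk_empty_add (χ := χ) (F := E₁) P.pos_ne_zero Finset.univ
  have h7 : (coloursAt χ Finset.univ E₁).card ≤ numColours χ X := by
    refine card_coloursAt_le_numColours fun e he v hv => ?_
    obtain ⟨Y, hY, he⟩ := Finset.mem_biUnion.1 he
    rw [Finset.mem_filter] at hY
    exact hX Y hY.1 hY.2 ((mem_inducedEdges.1 he).2 v hv)
  have h8 := Finset.sum_filter_add_sum_filter_not 𝒳 (fun Y => 3 ≤ Y.card)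
    (fun Y => 2 * (Y.card : ℤ) - 3)
  have h9 : ∑ Y ∈ 𝒴, (2 * (Y.card : ℤ) - 3) + ∑ Y ∈ 𝒵, (2 * (Y.card : ℤ) - 3) =
    ∑ Y ∈ 𝒳, (2 * (Y.card : ℤ) - 3) := h8
  omega

/-- The rank is at least the value of some restricted `1`-thin cover. -/
theorem Framework.IsGeneric.exists_cover_le (hP : P.IsGeneric) (hnd : ∀ e ∈ E, ¬ e.IsDiag)
    (hk : numColours χ Finset.univ ≤ 2) :
    ∃ (X : Finset V) (𝒳 : Finset (Finset V)), (∀ Y ∈ 𝒳, 2 ≤ Y.card) ∧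
      (∀ e ∈ E, ∃ Y ∈ 𝒳, ∀ v ∈ e, v ∈ Y) ∧ IsOneThin 𝒳 ∧ IsRestricted X 𝒳 ∧
      ∑ Y ∈ 𝒳, (2 * (Y.card : ℤ) - 3) + numColours χ X ≤ rk χ P.pos Finset.univ E := by
  classical
  have hk' : ∀ F, (coloursAt χ Finset.univ F).card ≤ 2 := fun F =>
    (card_coloursAt_le_numColours fun _ _ v _ => Finset.mem_univ v).trans hk
  obtain ⟨T, hTE, hle⟩ := exists_card_sdiff_add_le (χ := χ) (p := P.pos) (D := Finset.univ)
    (E := E) fun F hF hind => hP.rk_eq_card_of_forall_le hk' Finset.univ Finset.univ F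
      (fun e he => hnd e (hF he)) (fun _ _ v _ => Finset.mem_univ v) hind
  obtain ⟨𝒴, h𝒴, hthin, hcov, hsum⟩ := hP.exists_cover (χ := χ) fun e he => hnd e (hTE he)
  let X : Finset V := Finset.univ.filter fun v => ∃ e ∈ T, v ∈ e
  -- Edges outside T become two-element members; those inside a member of 𝒴 are already covered and
  -- would break 1-thinness.
  let 𝒵 : Finset (Finset V) :=
    ((E \ T).image Sym2.toFinset).filter fun Z => ∀ Y ∈ 𝒴, ¬ Z ⊆ Y
  have h𝒵 : ∀ Z ∈ 𝒵, Z.card = 2 ∧ ∀ Y ∈ 𝒴, ¬ Z ⊆ Y := fun Z hZ => by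
    rw [Finset.mem_filter, Finset.mem_image] at hZ
    obtain ⟨⟨e, he, rfl⟩, hZ⟩ := hZ
    exact ⟨Sym2.card_toFinset_of_not_isDiag e (hnd e (Finset.mem_sdiff.1 he).1), hZ⟩
  have hpair : ∀ Z ∈ 𝒵, ∀ Y, ¬ Z ⊆ Y → (Z ∩ Y).card ≤ 1 := fun Z hZ Y h => by
    have h1 := Finset.card_lt_card (Finset.inter_subset_left.ssubset_of_ne fun h' =>
      h (Finset.inter_eq_left.1 h'))
    have := (h𝒵 Z hZ).1
    omega
  have hX : numColours χ X ≤ (coloursAt χ Finset.univ T).card :=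
    numColours_le_card_coloursAt fun v hv => (Finset.mem_filter.1 hv).2
  refine ⟨X, 𝒴 ∪ 𝒵, fun Y hY => ?_, fun e he => ?_, ?_, fun Y hY h3 => ?_, ?_⟩
  · rcases Finset.mem_union.1 hY with hY | hY
    · exact (h𝒴 Y hY).1
    · exact (h𝒵 Y hY).1.ge
  · by_cases h : ∃ Y ∈ 𝒴, ∀ v ∈ e, v ∈ Y
    · obtain ⟨Y, hY, h⟩ := h
      exact ⟨Y, Finset.mem_union_left _ hY, h⟩
    · refine ⟨e.toFinset, Finset.mem_union_right _ (Finset.mem_filter.2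
        ⟨Finset.mem_image_of_mem _ (Finset.mem_sdiff.2 ⟨he, fun heT => h (hcov e heT)⟩),
          fun Y hY hs => h ⟨Y, hY, fun v hv => hs (Sym2.mem_toFinset.2 hv)⟩⟩),
        fun v hv => Sym2.mem_toFinset.2 hv⟩
  · intro Y hY Z hZ hne
    rcases Finset.mem_union.1 hY with hY | hY
    · rcases Finset.mem_union.1 hZ with hZ | hZ
      · exact hthin Y hY Z hZ hne
      · rw [Finset.inter_comm]
        exact hpair Z hZ Y ((h𝒵 Z hZ).2 Y hY)
    · refine hpair Y hY Z fun hs => ?_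
      rcases Finset.mem_union.1 hZ with hZ | hZ
      · exact (h𝒵 Y hY).2 Z hZ hs
      · exact hne (Finset.eq_of_subset_of_card_le hs (by rw [(h𝒵 Y hY).1, (h𝒵 Z hZ).1]))
  · rcases Finset.mem_union.1 hY with hY | hY
    · exact fun v hv => Finset.mem_filter.2 ⟨Finset.mem_univ v, (h𝒴 Y hY).2 v hv⟩
    · have := (h𝒵 Y hY).1
      omega
  · have hdis : Disjoint 𝒴 𝒵 := Finset.disjoint_left.2 fun Y hY hZ => (h𝒵 Y hZ).2 Y hY subset_rfl
    rw [Finset.sum_union hdis]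
    have h1 : ∑ Z ∈ 𝒵, (2 * (Z.card : ℤ) - 3) = 𝒵.card := by
      rw [Finset.card_eq_sum_ones, Nat.cast_sum]
      refine Finset.sum_congr rfl fun Z hZ => ?_
      rw [(h𝒵 Z hZ).1]
      norm_num
    have h2 : 𝒵.card ≤ (E \ T).card :=
      (Finset.card_filter_le _ _).trans Finset.card_image_le
    omega

end Covers

end ExpandingSpheres

end

theorem mainTheorem3 {V C : Type*} [Fintype V] [DecidableEq V] [Fintype C] [DecidableEq C]
    (G : SimpleGraph V) (χ : V → Option C)
    (hk : ExpandingSpheres.numColours χ Finset.univ ≤ 2)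
    (P : ExpandingSpheres.Framework 2 χ) (hP : P.IsGeneric) :
    IsLeast
      {m : ℤ | ∃ (X : Finset V) (𝒳 : Finset (Finset V)),
        ExpandingSpheres.IsCover G 𝒳 ∧ ExpandingSpheres.IsOneThin 𝒳 ∧
        ExpandingSpheres.IsRestricted X 𝒳 ∧
        m = (Fintype.card V : ℤ) + (∑ Y ∈ 𝒳, (2 * (Y.card : ℤ) - 3) +
          (ExpandingSpheres.numColours χ X : ℤ))}
      ((ExpandingSpheres.rigidityMatrix G χ P.p).rank : ℤ) := by
  classical
  have hE : ∀ e, e ∈ G.edgeSet.toFinset ↔ e ∈ G.edgeSet := fun e => Set.mem_toFinset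
  have hnd : ∀ e ∈ G.edgeSet.toFinset, ¬ e.IsDiag := fun e he =>
    G.not_isDiag_of_mem_edgeSet ((hE e).1 he)
  rw [ExpandingSpheres.rank_rigidityMatrix G P hE, Nat.cast_add]
  have hle : ∀ (X : Finset V) (𝒳 : Finset (Finset V)), ExpandingSpheres.IsCover G 𝒳 →
      ExpandingSpheres.IsRestricted X 𝒳 →
      (ExpandingSpheres.rk χ P.pos Finset.univ G.edgeSet.toFinset : ℤ) ≤
        ∑ Y ∈ 𝒳, (2 * (Y.card : ℤ) - 3) + ExpandingSpheres.numColours χ X := by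
    intro X 𝒳 hcov hX
    refine hP.rk_le_of_cover hnd hcov.1 (fun e he => ?_) hX
    induction e with | _ u w => ?_
    obtain ⟨Y, hY, hu, hw⟩ := hcov.2 u w ((hE _).1 he)
    refine ⟨Y, hY, ?_⟩
    simp only [Sym2.mem_iff, forall_eq_or_imp, forall_eq]
    exact ⟨hu, hw⟩
  constructor
  · obtain ⟨X, 𝒳, h2, hcov, hthin, hX, hval⟩ := hP.exists_cover_le hnd hk
    have hc : ExpandingSpheres.IsCover G 𝒳 := ⟨h2, fun u w huw => by
      obtain ⟨Y, hY, h⟩ := hcov s(u, w) ((hE _).2 huw)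
      exact ⟨Y, hY, h u (Sym2.mem_mk_left u w), h w (Sym2.mem_mk_right u w)⟩⟩
    exact ⟨X, 𝒳, hc, hthin, hX, by rw [le_antisymm (hle X 𝒳 hc hX) hval]⟩
  · rintro m ⟨X, 𝒳, hc, -, hX, rfl⟩
    exact Int.add_le_add_left (hle X 𝒳 hc hX) _
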